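/- Let $A$ be a $\mathrm{C}^*$-algebra (not necessarily unital). **The Pedersen ideal and $T_{\mathbb R}(A)$.** Let $\mathrm{Ped}(A)_0$ be the set of $a\in A_+$ for which there is $e\in A_+$ with $ea=a$, let $\mathrm{Ped}(A)_+$ be the set of $a\in A_+$ with $a\le\sum_{j=1}^n a_j$ for some $a_1,\dots,a_n\in\mathrm{Ped}(A)_0$, and let the Pedersen ideal $\mathrm{Ped}(A)$ be the linear span of $\mathrm{Ped}(A)_+$; it is a two-sided $*$-ideal of $A$. Equip $\mathrm{Ped}(A)$ with the locally convex direct limit topology, i.e. the finest locally convex vector space topology for which the inclusion $D\to\mathrm{Ped}(A)$ is continuous for every $\mathrm{C}^*$-subalgebra $D$ of $A$ with $D\subseteq\mathrm{Ped}(A)$ ($D$ with the norm topology). Let $T_{\mathbb R}(A)$ be the real vector space of continuous linear functionals $\tau\colon\mathrm{Ped}(A)\to\mathbb C$ that are self-adjoint ($\tau(a^*)=\overline{\tau(a)}$) and tracial ($\tau(ab)=\tau(ba)$), with the weak$^*$-topology (pointwise convergence on $\mathrm{Ped}(A)$) and the positive cone $T_+(A)$ of those $\tau$ with $\tau(a)\ge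 0$ for all $a\in\mathrm{Ped}(A)\cap A_+$. **The subalgebra.** Let $A_0\subseteq\mathrm{Ped}(A)$ be a (not necessarily closed) $*$-subalgebra with a subset $X\subseteq A_0$ such that 1. $XA_0=A_0$, where $XA_0=\{xa: x\in X,\ a\in A_0\}$; 2. the only closed two-sided ideal of $A$ containing $X$ is $A$ itself; 3. $xA_0y^*$ is dense in $\overline{xAy^*}$ for all $x,y\in X$. Let $T_{\mathbb R}(A_0,X)$ be the real vector space of self-adjoint tracial linear functionals $\tau_0\colon A_0\to\mathbb C$ such that $\tau_0|_{xA_0x^*}$ is bounded in norm for every $x\in X$, with the cone of those $\tau_0$ with $\tau_0(a^*a)\ge 0$ for all $a\in A_0$. For $x\in X$ the restriction $\tau_0|_{xA_0x^*}$ extends uniquely to a bounded linear functional $\tau_0^x$ on $\overline{xA_0x^*}=\overline{xAx^*}$; equip $T_{\mathbb R}(A_0,X)$ with the weakest topology for which $\tau_0\mapsto\tau_0^x(a)$ is continuous for all $x\in X$ and $a\in\overline{xAx^*}$. **Proposition.** The restriction map $$T_{\mathbb R}(A)\to T_{\mathbb R}(A_0,X),\qquad \tau\mapsto\tau|_{A_0},$$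 is well-defined and is an isomorphism of ordered topological vector spaces: it is a real-linear bijection and a homeomorphism, and $\tau|_{A_0}$ is positive if and only if $\tau$ is positive. -/

import Mathlib

open Filter
open scoped Topology ComplexOrder Pointwise

namespace PedTrace

section Unitization

variable {A : Type*} [NonUnitalCStarAlgebra A]

/-- Right multiplication of `A` by an element of the unitization. -/
def rightMul (u : Unitization ℂ A) (x : A) : A := u.fst • x + x * u.snd

lemma inr_rightMul (u : Unitization ℂ A) (x : A) :
    ((rightMul u x : A) : Unitization ℂ A) = (x : Unitization ℂ A) * u := by
  refine Unitization.ext ?_ ?_ <;> simp [rightMul]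

/-- Conjugation `x ↦ u* x u` by an element of the unitization. -/
def conjU (u : Unitization ℂ A) (x : A) : A := star (rightMul u (star (rightMul u x)))

lemma inr_conjU (u : Unitization ℂ A) (x : A) :
    ((conjU u x : A) : Unitization ℂ A) = star u * (x : Unitization ℂ A) * u := by
  simp [conjU, inr_rightMul, Unitization.inr_star, mul_assoc]

lemma conjU_star_mul (u : Unitization ℂ A) (x : A) :
    conjU u (star x * x) = star (rightMul u x) * rightMul u x := by
  apply Unitization.inr_injective (R := ℂ)
  simp [inr_conjU, inr_rightMul, Unitization.inr_star, Unitization.inr_mul, mul_assoc]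

lemma conjU_sub (u : Unitization ℂ A) (x y : A) : conjU u (x - y) = conjU u x - conjU u y := by
  apply Unitization.inr_injective (R := ℂ)
  simp [inr_conjU, Unitization.inr_sub, mul_sub, sub_mul]

lemma conjU_sum (u : Unitization ℂ A) {n : ℕ} (x : Fin n → A) :
    conjU u (∑ j, x j) = ∑ j, conjU u (x j) := by
  let f : A →+ A := AddMonoidHom.ofMapSub (conjU u) (conjU_sub u)
  exact map_sum f x Finset.univ

lemma polarization (x y : A) :
    star x * y = (1 / 4 : ℂ) • (star (x + y) * (x + y) - star (x - y) * (x - y)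
      - Complex.I • (star (x + Complex.I • y) * (x + Complex.I • y)
      - star (x - Complex.I • y) * (x - Complex.I • y))) := by
  simp only [star_add, star_sub, star_smul, add_mul, mul_add, sub_mul, mul_sub, smul_mul_assoc,
    mul_smul_comm, smul_add, smul_sub, smul_smul, Complex.star_def, Complex.conj_I]
  ring_nf
  simp only [Complex.I_sq]
  module

end Unitization

section Pedersen

variable (A : Type*) [NonUnitalCStarAlgebra A] [PartialOrder A] [StarOrderedRing A]

/-- The positive elements `a` for which there is a positive `e` with `e a = a`. -/
def pedZero : Set A := {a | 0 ≤ a ∧ ∃ e : A, 0 ≤ e ∧ e * a = a}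

/-- The hereditary cone generated by `pedZero A`: the positive elements that are dominated by a
finite sum of elements of `pedZero A`. -/
def pedPos : Set A :=
  {a | 0 ≤ a ∧ ∃ (n : ℕ) (b : Fin n → A), (∀ j, b j ∈ pedZero A) ∧ a ≤ ∑ j, b j}

/-- The linear span of `pedPos A`. -/
def pedSpan : Submodule ℂ A := Submodule.span ℂ (pedPos A)

variable {A}

set_option linter.unusedSectionVars false in
lemma pedPos_of_le {a b : A} (ha : 0 ≤ a) (hab : a ≤ b) (hb : b ∈ pedPos A) : a ∈ pedPos A := by
  obtain ⟨-, n, c, hc, h⟩ := hb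
  exact ⟨ha, n, c, hc, hab.trans h⟩

lemma pedPos_add {a b : A} (ha : a ∈ pedPos A) (hb : b ∈ pedPos A) : a + b ∈ pedPos A := by
  obtain ⟨ha0, n, c, hc, h⟩ := ha
  obtain ⟨hb0, m, d, hd, h'⟩ := hb
  refine ⟨add_nonneg ha0 hb0, n + m, Fin.append c d, fun j => ?_, ?_⟩
  · induction j using Fin.addCases with
    | left i => simpa using hc i
    | right i => simpa using hd i
  · simpa [Fin.sum_univ_add] using add_le_add h h'




lemma conjU_nonneg (u : Unitization ℂ A) {x : A} (hx : 0 ≤ x) : 0 ≤ conjU u x := by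
  obtain ⟨s, rfl⟩ := CStarAlgebra.nonneg_iff_eq_star_mul_self.mp hx
  rw [conjU_star_mul]
  exact star_mul_self_nonneg _



lemma conjU_mem_pedPos {u : Unitization ℂ A} (hu : u ∈ unitary (Unitization ℂ A)) {a : A}
    (ha : a ∈ pedPos A) : conjU u a ∈ pedPos A := by
  obtain ⟨ha0, n, b, hb, hab⟩ := ha
  refine ⟨conjU_nonneg u ha0, n, fun j => conjU u (b j), fun j => ?_, ?_⟩
  · obtain ⟨hb0, e, he0, he⟩ := hb j
    refine ⟨conjU_nonneg u hb0, conjU u e, conjU_nonneg u he0, ?_⟩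
    apply Unitization.inr_injective (R := ℂ)
    have h1 : u * star u = 1 := (Unitary.mem_iff.mp hu).2
    calc ((conjU u e * conjU u (b j) : A) : Unitization ℂ A)
        = star u * (e : Unitization ℂ A) * (u * star u) * (b j : Unitization ℂ A) * u := by
          simp only [Unitization.inr_mul, inr_conjU, mul_assoc]
      _ = star u * ((e * b j : A) : Unitization ℂ A) * u := by
          rw [h1, mul_one, Unitization.inr_mul]; simp only [mul_assoc]
      _ = _ := by rw [he, inr_conjU]
  · rw [← conjU_sum, ← sub_nonneg, ← conjU_sub]
    exact conjU_nonneg u (sub_nonneg.mpr hab)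


lemma star_mul_mem_pedSpan {x y : A} (hx : star x * x ∈ pedPos A) (hy : star y * y ∈ pedPos A) :
    star x * y ∈ pedSpan A := by
  have key : ∀ z : A, star z * z = star y * y →
      star (x + z) * (x + z) ∈ pedPos A ∧ star (x - z) * (x - z) ∈ pedPos A := by
    intro z hz
    have hs : star (x + z) * (x + z) + star (x - z) * (x - z)
        = (star x * x + star y * y) + (star x * x + star y * y) := by
      rw [← hz]
      simp only [star_add, star_sub, add_mul, mul_add, sub_mul, mul_sub]
      abel
    have hp := pedPos_add (pedPos_add hx hy) (pedPos_add hx hy)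
    rw [← hs] at hp
    exact ⟨pedPos_of_le (star_mul_self_nonneg _) (le_add_of_nonneg_right (star_mul_self_nonneg _))
        hp,
      pedPos_of_le (star_mul_self_nonneg _) (le_add_of_nonneg_left (star_mul_self_nonneg _)) hp⟩
  have h1 := key y rfl
  have h2 := key (Complex.I • y) (by
    simp [star_smul, smul_mul_assoc, mul_smul_comm, smul_smul])
  rw [polarization x y]
  have sub := fun {z : A} (hz : z ∈ pedPos A) => (Submodule.subset_span hz : z ∈ pedSpan A)
  exact Submodule.smul_mem _ _ (Submodule.sub_mem _ (Submodule.sub_mem _ (sub h1.1) (sub h1.2))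
    (Submodule.smul_mem _ _ (Submodule.sub_mem _ (sub h2.1) (sub h2.2))))

lemma rightMul_mem_pedSpan {a : A} (ha : a ∈ pedPos A) (v : Unitization ℂ A) :
    rightMul v a ∈ pedSpan A := by
  have hv : v ∈ Submodule.span ℂ (unitary (Unitization ℂ A) : Set (Unitization ℂ A)) := by
    rw [CStarAlgebra.span_unitary]; trivial
  induction hv using Submodule.span_induction with
  | mem u hu =>
    obtain ⟨s, hs⟩ := CStarAlgebra.nonneg_iff_eq_star_mul_self.mp ha.1
    have h : rightMul u a = star s * rightMul u s := by
      subst hs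
      simp [rightMul, mul_add, mul_assoc, mul_smul_comm]
    rw [h]
    refine star_mul_mem_pedSpan (hs ▸ ha) ?_
    rw [← conjU_star_mul, ← hs]
    exact conjU_mem_pedPos hu ha
  | zero => simp [rightMul]
  | add u w _ _ hu hw =>
    have : rightMul (u + w) a = rightMul u a + rightMul w a := by
      simp [rightMul, mul_add, add_smul]; abel
    rw [this]; exact Submodule.add_mem _ hu hw
  | smul c u _ hu =>
    have : rightMul (c • u) a = c • rightMul u a := by
      simp [rightMul, mul_smul_comm, smul_smul]
    rw [this]; exact Submodule.smul_mem _ _ hu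

/-- The span of `pedPos A` is a right ideal of `A`. -/
lemma pedSpan_mul_mem {a : A} (ha : a ∈ pedSpan A) (b : A) : a * b ∈ pedSpan A := by
  induction ha using Submodule.span_induction with
  | mem a ha => simpa [rightMul] using rightMul_mem_pedSpan ha (b : Unitization ℂ A)
  | zero => simp
  | add x y _ _ hx hy => rw [add_mul]; exact Submodule.add_mem _ hx hy
  | smul c x _ hx => rw [smul_mul_assoc]; exact Submodule.smul_mem _ _ hx

lemma star_mem_pedSpan {a : A} (ha : a ∈ pedSpan A) : star a ∈ pedSpan A := by
  induction ha using Submodule.span_induction with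
  | mem a ha =>
    rw [(IsSelfAdjoint.of_nonneg ha.1).star_eq]; exact Submodule.subset_span ha
  | zero => simp
  | add x y _ _ hx hy => rw [star_add]; exact Submodule.add_mem _ hx hy
  | smul c x _ hx => rw [star_smul]; exact Submodule.smul_mem _ _ hx

variable (A)

/-- The Pedersen ideal of `A`: the linear span of the hereditary cone generated by the positive
elements `a` that admit a positive `e` with `e a = a`. It is regarded as a `*`-subalgebra of `A`. -/
def Ped : NonUnitalStarSubalgebra ℂ A where
  carrier := pedSpan A
  add_mem' := Submodule.add_mem _
  zero_mem' := Submodule.zero_mem _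
  smul_mem' c _ hx := Submodule.smul_mem _ c hx
  mul_mem' {_ b} ha _ := pedSpan_mul_mem ha b
  star_mem' := star_mem_pedSpan

/-- The locally convex direct limit topology on `Ped A`: the finest locally convex vector space
topology for which the inclusion `D → Ped A` of every `C*`-subalgebra `D ⊆ Ped A` (a norm closed
`*`-subalgebra of `A` contained in `Ped A`) is continuous for the norm topology on `D`. -/
@[reducible] def pedTopology : TopologicalSpace (Ped A) :=
  sInf {t | @IsTopologicalAddGroup (Ped A) t _ ∧ @ContinuousSMul ℂ (Ped A) _ _ t ∧
    @LocallyConvexSpace ℝ (Ped A) _ _ _ _ t ∧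
    ∀ (D : NonUnitalStarSubalgebra ℂ A) (hD : D ≤ Ped A), IsClosed (D : Set A) →
      Continuous[inferInstance, t] (NonUnitalStarSubalgebra.inclusion hD)}

/-- `T_ℝ(A)`: the real vector space of self-adjoint tracial linear functionals on `Ped A` that are
continuous for the locally convex direct limit topology. -/
def TR : Submodule ℝ (Ped A →ₗ[ℂ] ℂ) where
  carrier := {τ | Continuous[pedTopology A, inferInstance] τ ∧
    (∀ x, τ (star x) = star (τ x)) ∧ ∀ x y, τ (x * y) = τ (y * x)}
  add_mem' := by
    rintro τ σ ⟨h1, h2, h3⟩ ⟨h1', h2', h3'⟩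
    refine ⟨?_, fun x => by simp [h2, h2'], fun x y => by simp [h3 x y, h3' x y]⟩
    let _ := pedTopology A
    exact Continuous.add (f := τ) (g := σ) h1 h1'
  zero_mem' := by
    let _ := pedTopology A
    exact ⟨continuous_const, by simp, by simp⟩
  smul_mem' := by
    rintro r τ ⟨h1, h2, h3⟩
    refine ⟨?_, fun x => by simp [h2], fun x y => by simp [h3 x y]⟩
    let _ := pedTopology A
    exact Continuous.const_smul (g := τ) h1 r

/-- The weak* topology on `T_ℝ(A)`: pointwise convergence on `Ped A`. -/
noncomputable instance : TopologicalSpace (TR A) :=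
  TopologicalSpace.induced (fun (τ : TR A) (a : Ped A) => (τ : Ped A →ₗ[ℂ] ℂ) a) inferInstance

/-- The positive cone `T_+(A)` of `T_ℝ(A)`. -/
def TPos : Set (TR A) :=
  {τ | ∀ a : Ped A, 0 ≤ (a : A) → 0 ≤ (τ : Ped A →ₗ[ℂ] ℂ) a}

end Pedersen

section Subalgebra

variable {A : Type*} [NonUnitalCStarAlgebra A]

/-- The element `x a x*` of `A₀`, for `x` and `a` in `A₀`. -/
def corner {A₀ : NonUnitalStarSubalgebra ℂ A} (x a : A₀) : A₀ := x * a * star x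

/-- `T_ℝ(A₀, X)`: the real vector space of self-adjoint tracial linear functionals on the
`*`-subalgebra `A₀` that are bounded on `x A₀ x*` for each `x ∈ X`. -/
def TR₀ (A₀ : NonUnitalStarSubalgebra ℂ A) (X : Set A₀) : Submodule ℝ (A₀ →ₗ[ℂ] ℂ) where
  carrier := {τ | (∀ a, τ (star a) = star (τ a)) ∧ (∀ a b, τ (a * b) = τ (b * a)) ∧
    ∀ x ∈ X, ∃ C : ℝ, ∀ a, ‖τ (corner x a)‖ ≤ C * ‖(corner x a : A)‖}
  add_mem' := by
    rintro τ σ ⟨h1, h2, h3⟩ ⟨h1', h2', h3'⟩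
    refine ⟨fun x => by simp [h1, h1'], fun x y => by simp [h2 x y, h2' x y], fun x hx => ?_⟩
    obtain ⟨C, hC⟩ := h3 x hx
    obtain ⟨C', hC'⟩ := h3' x hx
    refine ⟨C + C', fun a => ?_⟩
    rw [add_mul, LinearMap.add_apply]
    exact (norm_add_le _ _).trans (add_le_add (hC a) (hC' a))
  zero_mem' := ⟨by simp, by simp, fun x _ => ⟨0, by simp⟩⟩
  smul_mem' := by
    rintro r τ ⟨h1, h2, h3⟩
    refine ⟨fun x => by simp [h1], fun x y => by simp [h2 x y], fun x hx => ?_⟩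
    obtain ⟨C, hC⟩ := h3 x hx
    refine ⟨‖r‖ * C, fun a => ?_⟩
    rw [LinearMap.smul_apply, norm_smul, mul_assoc]
    exact mul_le_mul_of_nonneg_left (hC a) (norm_nonneg r)

/-- The value at `a`, a point of the closure of `x A₀ x*`, of the continuous extension of a
functional `τ` that is bounded on `x A₀ x*`: the limit of `τ (x b x*)` as `x b x*` tends to `a`. -/
noncomputable def extEval {A₀ : NonUnitalStarSubalgebra ℂ A} (x : A₀) (a : A)
    (τ : A₀ →ₗ[ℂ] ℂ) : ℂ :=
  limUnder (comap (fun b : A₀ => (corner x b : A)) (𝓝 a)) (fun b => τ (corner x b))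

/-- The limit that defines `extEval` exists for all functionals in `T_ℝ(A₀, X)`. -/
lemma tendsto_extEval {A₀ : NonUnitalStarSubalgebra ℂ A} {X : Set A₀} {τ : A₀ →ₗ[ℂ] ℂ}
    (hτ : τ ∈ TR₀ A₀ X) {x : A₀} (hx : x ∈ X) {a : A}
    (ha : a ∈ closure (Set.range fun b : A₀ => (corner x b : A))) :
    Tendsto (fun b => τ (corner x b)) (comap (fun b : A₀ => (corner x b : A)) (𝓝 a))
      (𝓝 (extEval x a τ)) := by
  obtain ⟨C, hC⟩ := hτ.2.2 x hx
  have : (comap (fun b : A₀ => (corner x b : A)) (𝓝 a)).NeBot := by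
    rw [comap_neBot_iff]
    intro t ht
    obtain ⟨_, h1, b, rfl⟩ := mem_closure_iff_nhds.mp ha t ht
    exact ⟨b, h1⟩
  apply tendsto_nhds_limUnder
  rw [← cauchy_map_iff_exists_tendsto, Metric.cauchy_iff]
  refine ⟨inferInstance, fun ε hε => ?_⟩
  have hK : 0 < |C| + 1 := by positivity
  refine ⟨_, image_mem_map (preimage_mem_comap
    (Metric.ball_mem_nhds a (show 0 < ε / (2 * (|C| + 1)) by positivity))), ?_⟩
  rintro _ ⟨b, hb, rfl⟩ _ ⟨b', hb', rfl⟩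
  have hsub : corner x b - corner x b' = corner x (b - b') := by
    simp [corner, mul_sub, sub_mul]
  have hd : ‖(corner x (b - b') : A)‖ < ε / (|C| + 1) := by
    have h1 : dist (corner x b : A) (corner x b' : A) < ε / (|C| + 1) := by
      refine (dist_triangle_right _ _ a).trans_lt ((add_lt_add hb hb').trans_eq ?_)
      field_simp
      norm_num
    rwa [dist_eq_norm, ← NonUnitalStarSubalgebra.coe_sub, hsub] at h1
  rw [dist_eq_norm, ← map_sub, hsub]
  calc ‖τ (corner x (b - b'))‖ ≤ C * ‖(corner x (b - b') : A)‖ := hC _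
    _ ≤ (|C| + 1) * ‖(corner x (b - b') : A)‖ :=
      mul_le_mul_of_nonneg_right ((le_abs_self C).trans (by linarith)) (norm_nonneg _)
    _ < (|C| + 1) * (ε / (|C| + 1)) := mul_lt_mul_of_pos_left hd hK
    _ = ε := by field_simp

/-- The topology on `T_ℝ(A₀, X)`: the weakest topology for which, for each `x ∈ X` and each `a` in
the closure of `x A x*`, evaluation at `a` of the extension to the closure of `x A₀ x*` is
continuous. (It is used when `x A₀ x*` is dense in the closure of `x A x*`.) -/
noncomputable instance (A₀ : NonUnitalStarSubalgebra ℂ A) (X : Set A₀) : TopologicalSpace (TR₀ A₀ X) :=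
  ⨅ x ∈ X, ⨅ a ∈ closure (Set.range fun b : A => (x : A) * b * star (x : A)),
    TopologicalSpace.induced (fun τ : TR₀ A₀ X => extEval x a τ) inferInstance

/-- The cone of positive elements of `T_ℝ(A₀, X)`. -/
def TPos₀ (A₀ : NonUnitalStarSubalgebra ℂ A) (X : Set A₀) : Set (TR₀ A₀ X) :=
  {τ | ∀ a : A₀, 0 ≤ (τ : A₀ →ₗ[ℂ] ℂ) (star a * a)}

end Subalgebra

end PedTrace

/-! Suppose `p = ∑ cᵢ* cᵢ` with `cᵢ ∈ closure (xᵢ A)` and `xᵢ ∈ X`. For a trace `τ` on the Pedersen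
ideal, `τ p = ∑ τ (cᵢ cᵢ*)`, and `cᵢ cᵢ*` lies in the corner `closure (xᵢ A xᵢ*) = closure (xᵢ A₀
xᵢ*)`, where `τ` is bounded and hence determined by its values on `xᵢ A₀ xᵢ*`. Because `X` generates
`A` as a closed ideal, every positive element of `Ped A` is such a sum (`pedPos_subset_sumCone`). So
each evaluation on `Ped A` is a finite combination of evaluations of extensions to corners
(`exists_mem_span_evalFunctionals`); this gives injectivity and continuity of the inverse, and the
same formula transfers positivity. The restriction is well-defined since `Ped A` contains the whole
closed corner of each of its elements (`mem_pedSpan_of_mem_rightIdeal`), so that continuity bounds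
`τ` there.

For surjectivity the formula becomes a definition: `τ p = ∑ φ xᵢ (cᵢ cᵢ*)`, with `φ x` a bounded
extension of `τ₀` from `x A₀ x*`. If also `p = ∑ dⱼ* dⱼ` and `r = √p`, the elements `zᵢⱼ = cᵢ r⁻¹
dⱼ*`, taken as limits, satisfy `∑ⱼ zᵢⱼ zᵢⱼ* = cᵢ cᵢ*` and `∑ᵢ zᵢⱼ* zᵢⱼ = dⱼ dⱼ*`; the trace identity
for each `zᵢⱼ` makes the two values agree (`IsTraceFamily.sum_eq_sum`). The same limits transport
decompositions of `a a*` to `a* a`, so `τ` is tracial, and to smaller positive elements, so `τ` is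
bounded below each fixed `p`. A gliding-hump argument turns the latter into continuity
(`exists_bound_of_dominated`). -/

namespace PedTrace

/-! ### Closed right ideals and approximate inverses -/

section RightIdeal

variable {A : Type*} [NonUnitalCStarAlgebra A]

/-- The closed right ideal `closure (x A)` of `A`. -/
def rightIdeal (x : A) : Submodule ℂ A :=
  (LinearMap.range (LinearMap.mulLeft ℂ x)).topologicalClosure

lemma mem_rightIdeal_iff {x c : A} :
    c ∈ rightIdeal x ↔ c ∈ closure (Set.range fun a : A => x * a) := Iff.rfl

lemma isClosed_rightIdeal (x : A) : IsClosed (rightIdeal x : Set A) :=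
  Submodule.isClosed_topologicalClosure _

lemma mul_mem_rightIdeal (x a : A) : x * a ∈ rightIdeal x :=
  subset_closure ⟨a, rfl⟩

lemma rightIdeal_mul_mem {x c : A} (hc : c ∈ rightIdeal x) (b : A) : c * b ∈ rightIdeal x := by
  refine map_mem_closure (f := fun c => c * b) (by fun_prop) (mem_rightIdeal_iff.mp hc) ?_
  rintro _ ⟨a, rfl⟩
  exact ⟨a * b, (mul_assoc _ _ _).symm⟩

lemma rightIdeal_le {x c : A} (hc : c ∈ rightIdeal x) : rightIdeal c ≤ rightIdeal x := by
  intro d hd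
  refine closure_minimal ?_ (isClosed_rightIdeal x) (mem_rightIdeal_iff.mp hd)
  rintro _ ⟨a, rfl⟩
  exact rightIdeal_mul_mem hc a

lemma mul_star_mem_closure {x y c d : A} (hc : c ∈ rightIdeal x) (hd : d ∈ rightIdeal y) :
    c * star d ∈ closure (Set.range fun a : A => x * a * star y) := by
  refine map_mem_closure₂ (f := fun c d => c * star d) (by fun_prop) (mem_rightIdeal_iff.mp hc)
    (mem_rightIdeal_iff.mp hd) ?_
  rintro _ ⟨a, rfl⟩ _ ⟨b, rfl⟩
  exact ⟨a * star b, by simp [mul_assoc]⟩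

lemma mem_rightIdeal_of_mem_closure {x y c : A}
    (hc : c ∈ closure (Set.range fun a : A => x * a * star y)) : c ∈ rightIdeal x := by
  refine closure_minimal ?_ (isClosed_rightIdeal x) hc
  rintro _ ⟨a, rfl⟩
  exact rightIdeal_mul_mem (mul_mem_rightIdeal x a) _

/-- A sequence that acts like an inverse of `r` on the closed right ideal generated by `r`. -/
structure IsQuasiInv (r : A) (g : ℕ → A) : Prop where
  isSelfAdjoint : ∀ n, IsSelfAdjoint (g n)
  norm_le : ∀ n, ‖r * g n‖ ≤ 1
  comm : ∀ n, r * g n = g n * r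
  tendsto : Tendsto (fun n => r * g n * r) atTop (𝓝 r)

lemma IsQuasiInv.tendsto_of_mem {r : A} {g : ℕ → A} (h : IsQuasiInv r g) {s : A}
    (hs : s ∈ rightIdeal r) : Tendsto (fun n => r * (g n * s)) atTop (𝓝 s) := by
  rw [Metric.tendsto_atTop]
  intro ε hε
  obtain ⟨_, ⟨a, rfl⟩, ha⟩ := Metric.mem_closure_iff.mp (mem_rightIdeal_iff.mp hs) (ε / 3)
    (by positivity)
  have h1 : Tendsto (fun n => r * g n * r * a) atTop (𝓝 (r * a)) := h.tendsto.mul_const a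
  obtain ⟨N, hN⟩ := Metric.tendsto_atTop.mp h1 (ε / 3) (by positivity)
  refine ⟨N, fun n hn => ?_⟩
  have h2 := hN n hn
  rw [dist_eq_norm] at ha h2 ⊢
  -- An `ε/3` argument: `‖r * g n‖ ≤ 1` controls the error from replacing `s` by `r * a`.
  have h3 : r * (g n * s) - s = r * g n * (s - r * a) + (r * g n * r * a - r * a)
      - (s - r * a) := by
    simp only [mul_sub, mul_assoc]; abel
  have h4 : ‖r * g n * (s - r * a)‖ ≤ ‖s - r * a‖ :=
    (norm_mul_le _ _).trans (mul_le_of_le_one_left (norm_nonneg _) (h.norm_le n))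
  rw [h3]
  have := norm_sub_le (r * g n * (s - r * a) + (r * g n * r * a - r * a)) (s - r * a)
  have := norm_add_le (r * g n * (s - r * a)) (r * g n * r * a - r * a)
  linarith

lemma IsQuasiInv.tendsto_self_mul {r : A} {g : ℕ → A} (h : IsQuasiInv r g) :
    Tendsto (fun n => r * (r * g n)) atTop (𝓝 r) := by
  refine h.tendsto.congr fun n => ?_
  rw [mul_assoc, ← h.comm]

variable [PartialOrder A] [StarOrderedRing A]

/-- Regularise `1/t` to `t / (t² + δ)` with `δ = 1/(n+1)`. It vanishes at `0`, so the non-unital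
functional calculus applies. -/
lemma exists_isQuasiInv {r : A} (hr : 0 ≤ r) : ∃ g : ℕ → A, IsQuasiInv r g := by
  have hsa : IsSelfAdjoint r := .of_nonneg hr
  let f : ℕ → ℝ → ℝ := fun n t => t / (t ^ 2 + 1 / ((n : ℝ) + 1))
  have hpos : ∀ (n : ℕ) (t : ℝ), 0 < t ^ 2 + 1 / ((n : ℝ) + 1) := fun n t => by positivity
  have hf : ∀ n, Continuous (f n) := fun n =>
    continuous_id.div (by fun_prop) fun t => (hpos n t).ne'
  have hf0 : ∀ n, f n 0 = 0 := fun n => by simp [f]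
  have hmul : ∀ n, r * cfcₙ (f n) r = cfcₙ (fun t => t * f n t) r := fun n => by
    rw [cfcₙ_mul (fun t => t) (f n) r (by fun_prop) rfl (hf n).continuousOn (hf0 n),
      cfcₙ_id' ℝ r]
  have hmul' : ∀ n, r * cfcₙ (f n) r * r = cfcₙ (fun t => t * f n t * t) r := fun n => by
    rw [hmul, cfcₙ_mul (fun t => t * f n t) (fun t => t) r
      (continuous_id.mul (hf n)).continuousOn (by simp) (by fun_prop) rfl, cfcₙ_id' ℝ r]
  refine ⟨fun n => cfcₙ (f n) r, fun n => cfcₙ_predicate _ _, fun n => ?_, fun n => ?_, ?_⟩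
  · rw [hmul]
    refine norm_cfcₙ_le fun t _ => ?_
    have h1 : t * f n t = t ^ 2 / (t ^ 2 + 1 / ((n : ℝ) + 1)) := by simp only [f]; ring
    rw [h1, Real.norm_of_nonneg (div_nonneg (sq_nonneg t) (hpos n t).le), div_le_one (hpos n t)]
    have : (0 : ℝ) < 1 / ((n : ℝ) + 1) := by positivity
    linarith
  · have := cfcₙ_commute_cfcₙ (R := ℝ) (fun t => t) (f n) r
    rwa [cfcₙ_id' ℝ r] at this
  · rw [tendsto_iff_norm_sub_tendsto_zero]
    have hlim : Tendsto (fun n : ℕ => Real.sqrt (1 / ((n : ℝ) + 1))) atTop (𝓝 0) := by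
      have := (Real.continuous_sqrt.tendsto 0).comp
        (tendsto_one_div_add_atTop_nhds_zero_nat (𝕜 := ℝ))
      simpa [Function.comp_def] using this
    refine squeeze_zero (fun _ => norm_nonneg _) (fun n => ?_) hlim
    have h2 : r * cfcₙ (f n) r * r - r = cfcₙ (fun t => t * f n t * t - t) r := by
      rw [cfcₙ_sub (fun t => t * f n t * t) (fun t => t) r
        ((continuous_id.mul (hf n)).mul continuous_id).continuousOn (by simp) (by fun_prop) rfl,
        cfcₙ_id' ℝ r, hmul']
    rw [h2]
    refine norm_cfcₙ_le fun t _ => ?_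
    set δ : ℝ := 1 / ((n : ℝ) + 1) with hδ
    have hδ0 : 0 < δ := by positivity
    have hd : 0 < t ^ 2 + δ := hpos n t
    have h3 : t * f n t * t - t = -(t * δ) / (t ^ 2 + δ) := by
      simp only [f, ← hδ]
      field_simp
      ring
    rw [h3, norm_div, Real.norm_of_nonneg hd.le, norm_neg, norm_mul, Real.norm_of_nonneg hδ0.le,
      div_le_iff₀ hd, Real.norm_eq_abs]
    have hs := Real.sq_sqrt hδ0.le
    have hs0 := Real.sqrt_nonneg δ
    rw [← sq_abs t]
    -- AM-GM gives `|t| √δ ≤ t² + δ`; multiplying by `√δ` yields the bound `√δ`.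
    nlinarith [sq_nonneg (|t| - Real.sqrt δ), mul_nonneg hs0 (sq_nonneg (|t| - Real.sqrt δ)),
      mul_nonneg hs0 (sq_nonneg (|t|)), mul_nonneg hs0 hδ0.le, mul_nonneg hδ0.le (abs_nonneg t)]

/-- Conjugate the inequality by `u` and apply the C*-identity. The unitization is needed for `u = g
n * r - 1`. -/
lemma norm_rightMul_le {a r : A} (hr : IsSelfAdjoint r) (h : star a * a ≤ r * r)
    (u : Unitization ℂ A) : ‖rightMul u a‖ ≤ ‖rightMul u r‖ := by
  have h1 : conjU u (star a * a) ≤ conjU u (star r * r) := by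
    rw [← sub_nonneg, ← conjU_sub, hr.star_eq]
    exact conjU_nonneg u (sub_nonneg.mpr h)
  rw [conjU_star_mul, conjU_star_mul] at h1
  have h2 := CStarAlgebra.norm_le_norm_of_nonneg_of_le (star_mul_self_nonneg _) h1
  rw [CStarRing.norm_star_mul_self, CStarRing.norm_star_mul_self] at h2
  exact (mul_self_le_mul_self_iff (norm_nonneg _) (norm_nonneg _)).mpr h2

lemma norm_mul_le_norm_mul {a r : A} (hr : IsSelfAdjoint r) (h : star a * a ≤ r * r) (u : A) :
    ‖a * u‖ ≤ ‖r * u‖ := by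
  simpa [rightMul] using norm_rightMul_le hr h (u : Unitization ℂ A)

lemma self_mem_rightIdeal_mul_self {r : A} (hr : 0 ≤ r) : r ∈ rightIdeal (r * r) := by
  obtain ⟨g, hg⟩ := exists_isQuasiInv hr
  refine mem_closure_of_tendsto hg.tendsto_self_mul (.of_forall fun n => ⟨g n, ?_⟩)
  exact mul_assoc _ _ _

/-- `r gₙ a → a`, because `‖r gₙ a - a‖ = ‖a* (gₙ r - 1)‖ ≤ ‖r (gₙ r - 1)‖ → 0`. -/
lemma mem_rightIdeal_of_mul_star_le {r a : A} (hr : 0 ≤ r) (h : a * star a ≤ r * r) :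
    a ∈ rightIdeal r := by
  obtain ⟨g, hg⟩ := exists_isQuasiInv hr
  have hsa : IsSelfAdjoint r := .of_nonneg hr
  have key : Tendsto (fun n => r * (g n * a)) atTop (𝓝 a) := by
    rw [tendsto_iff_norm_sub_tendsto_zero]
    refine squeeze_zero (fun _ => norm_nonneg _) (fun n => ?_)
      (tendsto_iff_norm_sub_tendsto_zero.mp hg.tendsto)
    have h1 := norm_rightMul_le (a := star a) hsa (by simpa using h)
      ((g n * r : A) - 1 : Unitization ℂ A)
    have h2 : ∀ x : A, rightMul ((g n * r : A) - 1 : Unitization ℂ A) x = x * (g n * r) - x := by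
      intro x
      apply Unitization.inr_injective (R := ℂ)
      rw [inr_rightMul]
      simp [mul_sub, Unitization.inr_sub]
    rw [h2, h2, ← norm_star] at h1
    simpa [mul_assoc, hsa.star_eq, (hg.isSelfAdjoint n).star_eq] using h1
  exact mem_closure_of_tendsto key (.of_forall fun n => ⟨g n * a, rfl⟩)

lemma self_mem_rightIdeal (c : A) : c ∈ rightIdeal c := by
  have h0 : 0 ≤ c * star c := mul_star_self_nonneg c
  have h1 := CFC.sqrt_mul_sqrt_self (c * star c) h0
  have h2 : c ∈ rightIdeal (CFC.sqrt (c * star c)) :=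
    mem_rightIdeal_of_mul_star_le (CFC.sqrt_nonneg _) h1.ge
  have h3 := rightIdeal_le (self_mem_rightIdeal_mul_self (CFC.sqrt_nonneg (c * star c))) h2
  rw [h1] at h3
  exact rightIdeal_le (mul_mem_rightIdeal _ _) h3

/-- The limit plays the role of `a r⁻¹ s`: since `‖a u‖ ≤ ‖r u‖`, the sequence is Cauchy along with
`r gₙ s`, which tends to `s`. -/
lemma IsQuasiInv.exists_tendsto {r : A} (hr : 0 ≤ r) {g : ℕ → A} (hg : IsQuasiInv r g) {a s : A}
    (ha : star a * a ≤ r * r) (hs : s ∈ rightIdeal r) :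
    ∃ w, Tendsto (fun n => a * (g n * s)) atTop (𝓝 w) := by
  apply cauchySeq_tendsto_of_complete
  have h1 := Metric.cauchySeq_iff.mp (hg.tendsto_of_mem hs).cauchySeq
  refine Metric.cauchySeq_iff.mpr fun ε hε => ?_
  obtain ⟨N, hN⟩ := h1 ε hε
  refine ⟨N, fun m hm n hn => lt_of_le_of_lt ?_ (hN m hm n hn)⟩
  rw [dist_eq_norm, dist_eq_norm, ← mul_sub, ← mul_sub]
  exact norm_mul_le_norm_mul (.of_nonneg hr) ha _

/-- If `∑ aᵢ* aᵢ = r²` and `s` is in the closed right ideal generated by `r`, then the limits `wᵢ`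
of `aᵢ r⁻¹ s` exist and `∑ wᵢ* wᵢ = s* s`. -/
lemma IsQuasiInv.exists_sum_star_mul {r : A} (hr : 0 ≤ r) {g : ℕ → A} (hg : IsQuasiInv r g)
    {ι : Type*} [Fintype ι] {a : ι → A} (ha : ∑ i, star (a i) * a i = r * r) {s : A}
    (hs : s ∈ rightIdeal r) :
    ∃ w : ι → A, (∀ i, Tendsto (fun n => a i * (g n * s)) atTop (𝓝 (w i))) ∧
      ∑ i, star (w i) * w i = star s * s := by
  have hle : ∀ i, star (a i) * a i ≤ r * r := fun i => by
    rw [← ha]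
    exact Finset.single_le_sum (f := fun i => star (a i) * a i)
      (fun i _ => star_mul_self_nonneg _) (Finset.mem_univ i)
  choose w hw using fun i => hg.exists_tendsto hr (hle i) hs
  refine ⟨w, hw, ?_⟩
  have h1 : Tendsto (fun n => ∑ i, star (a i * (g n * s)) * (a i * (g n * s))) atTop
      (𝓝 (∑ i, star (w i) * w i)) :=
    tendsto_finsetSum _ fun i _ => (hw i).star.mul (hw i)
  have h2 := (hg.tendsto_of_mem hs).star.mul (hg.tendsto_of_mem hs)
  refine tendsto_nhds_unique h1 (h2.congr fun n => ?_)
  have h3 : ∀ i, star (a i * (g n * s)) * (a i * (g n * s))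
      = star (g n * s) * (star (a i) * a i) * (g n * s) := fun i => by
    rw [star_mul (a i)]; simp only [mul_assoc]
  simp only [h3]
  rw [← Finset.sum_mul, ← Finset.mul_sum, ha, star_mul r, (IsSelfAdjoint.of_nonneg hr).star_eq]
  simp only [mul_assoc]

/-- Every element `c` has the form `r w`, where `r` is positive and lies in `closure (c A)`. -/
lemma exists_nonneg_mul_eq (c : A) : ∃ r w : A, 0 ≤ r ∧ r ∈ rightIdeal c ∧ r * w = c := by
  -- With `q = |c*|`, take `r = q^(1/2)` and `w = lim gₙ c`. The limit exists because `‖(gₘ - gₙ) c‖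
  -- ≤ ‖q (gₘ - gₙ)‖ = ‖r (r gₘ) - r (r gₙ)‖`.
  set q := CFC.sqrt (c * star c) with hq
  set r := CFC.sqrt q with hr
  have hq0 : 0 ≤ q := CFC.sqrt_nonneg _
  have hr0 : 0 ≤ r := CFC.sqrt_nonneg _
  have hqq : q * q = c * star c := CFC.sqrt_mul_sqrt_self _ (mul_star_self_nonneg c)
  have hrr : r * r = q := CFC.sqrt_mul_sqrt_self _ hq0
  have hrq : r ∈ rightIdeal q := hrr ▸ self_mem_rightIdeal_mul_self hr0
  have hqc : q ∈ rightIdeal (c * star c) := hqq ▸ self_mem_rightIdeal_mul_self hq0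
  have hcr : c ∈ rightIdeal r := by
    refine rightIdeal_le ?_ (mem_rightIdeal_of_mul_star_le hq0 hqq.ge)
    rw [← hrr]; exact mul_mem_rightIdeal r r
  have hrc : r ∈ rightIdeal c := rightIdeal_le (mul_mem_rightIdeal c _) (rightIdeal_le hqc hrq)
  obtain ⟨g, hg⟩ := exists_isQuasiInv hr0
  have hw : ∃ w, Tendsto (fun n => g n * c) atTop (𝓝 w) := by
    apply cauchySeq_tendsto_of_complete
    have h1 := Metric.cauchySeq_iff.mp hg.tendsto_self_mul.cauchySeq
    refine Metric.cauchySeq_iff.mpr fun ε hε => ?_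
    obtain ⟨N, hN⟩ := h1 ε hε
    refine ⟨N, fun m hm n hn => lt_of_le_of_lt ?_ (hN m hm n hn)⟩
    have h2 := norm_mul_le_norm_mul (a := star c) (.of_nonneg hq0) (by simpa using hqq.ge)
      (g m - g n)
    rw [dist_eq_norm, dist_eq_norm, ← sub_mul, ← mul_sub, ← mul_sub, ← mul_assoc, hrr,
      ← norm_star ((g m - g n) * c), star_mul, star_sub, (hg.isSelfAdjoint m).star_eq,
      (hg.isSelfAdjoint n).star_eq]
    exact h2
  obtain ⟨w, hw⟩ := hw
  exact ⟨r, w, hr0, hrc, tendsto_nhds_unique (hw.const_mul r) (hg.tendsto_of_mem hcr)⟩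

end RightIdeal

lemma exists_eq_of_mem_span_cone {M : Type*} [AddCommGroup M] [Module ℂ M] {s : Set M} (h0 : 0 ∈ s)
    (hadd : ∀ x ∈ s, ∀ y ∈ s, x + y ∈ s) (hsmul : ∀ r : ℝ, 0 ≤ r → ∀ x ∈ s, (r : ℂ) • x ∈ s)
    {x : M} (hx : x ∈ Submodule.span ℂ s) :
    ∃ p ∈ s, ∃ q ∈ s, ∃ p' ∈ s, ∃ q' ∈ s, x = p - q + Complex.I • (p' - q') := by
  induction hx using Submodule.closure_induction with
  | zero => exact ⟨0, h0, 0, h0, 0, h0, 0, h0, by simp⟩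
  | add x y _ _ hx hy =>
    obtain ⟨p, hp, q, hq, p', hp', q', hq', rfl⟩ := hx
    obtain ⟨u, hu, v, hv, u', hu', v', hv', rfl⟩ := hy
    refine ⟨_, hadd p hp u hu, _, hadd q hq v hv, _, hadd p' hp' u' hu', _, hadd q' hq' v' hv', ?_⟩
    module
  | smul_mem c x hx =>
    refine ⟨_, hsmul (c.re⁺) (posPart_nonneg _) x hx, _, hsmul (c.re⁻) (negPart_nonneg _) x hx,
      _, hsmul (c.im⁺) (posPart_nonneg _) x hx, _, hsmul (c.im⁻) (negPart_nonneg _) x hx, ?_⟩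
    rw [← sub_smul, ← sub_smul, ← Complex.ofReal_sub, ← Complex.ofReal_sub, posPart_sub_negPart,
      posPart_sub_negPart, smul_smul, ← add_smul, mul_comm, Complex.re_add_im]

/-! ### The Pedersen ideal absorbs closed right ideals -/

section Pedersen

variable {A : Type*} [NonUnitalCStarAlgebra A]

lemma eq_and_eq_of_sub_add_I_smul_eq_zero {p q p' q' : A} (hp : IsSelfAdjoint p)
    (hq : IsSelfAdjoint q) (hp' : IsSelfAdjoint p') (hq' : IsSelfAdjoint q')
    (h : p - q + Complex.I • (p' - q') = 0) : p = q ∧ p' = q' := by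
  have h1 : p - q - Complex.I • (p' - q') = 0 := by
    have := congrArg star h
    simpa only [star_add, star_sub, star_smul, star_zero, hp.star_eq, hq.star_eq, hp'.star_eq,
      hq'.star_eq, Complex.star_def, Complex.conj_I, neg_smul, ← sub_eq_add_neg] using this
  constructor
  · have h2 : (2 : ℂ) • (p - q) = 0 := by
      have := congrArg₂ (· + ·) h h1
      simp only [add_zero] at this
      rw [← this]; module
    exact sub_eq_zero.mp ((smul_eq_zero_iff_right two_ne_zero).mp h2)
  · have h2 : (2 * Complex.I) • (p' - q') = 0 := by
      have := congrArg₂ (· - ·) h h1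
      simp only [sub_zero] at this
      rw [← this]; module
    exact sub_eq_zero.mp ((smul_eq_zero_iff_right (by simp)).mp h2)

variable [PartialOrder A]

lemma zero_mem_pedPos : (0 : A) ∈ pedPos A :=
  ⟨le_rfl, 0, Fin.elim0, fun j => j.elim0, by simp⟩

lemma mem_pedSpan_of_mem_pedZero {a : A} (ha : a ∈ pedZero A) : a ∈ pedSpan A :=
  Submodule.subset_span ⟨ha.1, 1, fun _ => a, fun _ => ha, by simp⟩

variable [StarOrderedRing A]

lemma ofReal_smul_nonneg {r : ℝ} (hr : 0 ≤ r) {a : A} (ha : 0 ≤ a) : 0 ≤ (r : ℂ) • a := by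
  rw [Complex.coe_smul]
  exact smul_nonneg hr ha

lemma smul_mem_pedPos {r : ℝ} (hr : 0 ≤ r) {a : A} (ha : a ∈ pedPos A) :
    (r : ℂ) • a ∈ pedPos A := by
  obtain ⟨ha0, n, b, hb, hab⟩ := ha
  refine ⟨ofReal_smul_nonneg hr ha0, n, fun j => (r : ℂ) • b j, fun j => ?_, ?_⟩
  · obtain ⟨h0, e, he0, he⟩ := hb j
    exact ⟨ofReal_smul_nonneg hr h0, e, he0, by rw [mul_smul_comm, he]⟩
  · rw [← Finset.smul_sum, ← sub_nonneg, ← smul_sub]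
    exact ofReal_smul_nonneg hr (sub_nonneg.mpr hab)

/-- Write `a = p - q + i (p' - q')` over the cone; comparing self-adjoint parts gives `a = p - q ≤
p`, and the cone is hereditary. -/
lemma mem_pedPos_of_nonneg {a : A} (ha : a ∈ pedSpan A) (h0 : 0 ≤ a) : a ∈ pedPos A := by
  obtain ⟨p, hp, q, hq, p', hp', q', hq', h⟩ := exists_eq_of_mem_span_cone zero_mem_pedPos
    (fun x hx y hy => pedPos_add hx hy) (fun r hr x hx => smul_mem_pedPos hr hx) ha
  have h1 : p - (q + a) + Complex.I • (p' - q') = 0 := by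
    rw [← sub_eq_zero.mpr h.symm]; abel
  obtain ⟨h2, -⟩ := eq_and_eq_of_sub_add_I_smul_eq_zero (.of_nonneg hp.1)
    (.of_nonneg (add_nonneg hq.1 h0)) (.of_nonneg hp'.1) (.of_nonneg hq'.1) h1
  exact pedPos_of_le h0 (by rw [h2]; exact le_add_of_nonneg_left hq.1) hp

lemma mul_mem_pedSpan {a : A} (ha : a ∈ pedSpan A) (b : A) : b * a ∈ pedSpan A := by
  simpa using star_mem_pedSpan (pedSpan_mul_mem (star_mem_pedSpan ha) (star b))

/-- Here `w` need not be positive. Replace `e` by `k(e)`, where `k(t) = max 0 (2t - 1)`: it still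
fixes `w` because `k(1) = 1`, and it has the local unit `max 0 (min 1 (2t))`, so it lies in `pedZero
A`. -/
lemma mem_pedSpan_of_mul_eq {e w : A} (he : 0 ≤ e) (h : e * w = w) : w ∈ pedSpan A := by
  let m : ℝ → ℝ := fun t => min t (1 / 2) / (1 - min t (1 / 2))
  let k : ℝ → ℝ := fun t => max 0 (2 * t - 1)
  have hd : ∀ t : ℝ, 0 < 1 - min t (1 / 2) := fun t => by
    have := min_le_right t (1 / 2); linarith
  have hm : Continuous m := Continuous.div (by fun_prop) (by fun_prop) fun t => (hd t).ne'
  have hm0 : m 0 = 0 := by simp [m]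
  have hk : Continuous k := by fun_prop
  have hk0 : k 0 = 0 := by simp [k]
  -- The function `m` is chosen so that `k(t) = t + m(t) (t - 1)`; the second term kills `w` since
  -- `e w = w`. No unit is needed.
  have hkm : cfcₙ k e = e + cfcₙ m e * e - cfcₙ m e := by
    have h1 : cfcₙ k e = cfcₙ (fun t => t + m t * t - m t) e := by
      refine cfcₙ_congr fun t ht => ?_
      have ht0 : 0 ≤ t := quasispectrum_nonneg_of_nonneg e he t ht
      have hmt : m t * (1 - min t (1 / 2)) = min t (1 / 2) := div_mul_cancel₀ _ (hd t).ne'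
      rcases le_total t (1 / 2) with h2 | h2
      · rw [min_eq_left h2] at hmt
        simp only [k]
        rw [max_eq_left (by linarith)]
        linarith
      · rw [min_eq_right h2] at hmt
        have hm1 : m t = 1 := by linarith
        simp only [k, hm1]
        rw [max_eq_right (by linarith)]
        ring
    rw [h1, cfcₙ_sub (fun t => t + m t * t) m e (by fun_prop) (by simp) hm.continuousOn hm0,
      cfcₙ_add (fun t => t) (fun t => m t * t) e (by fun_prop) rfl (by fun_prop) (by simp),
      cfcₙ_mul m (fun t => t) e hm.continuousOn hm0 (by fun_prop) rfl, cfcₙ_id' ℝ e]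
  have hkw : cfcₙ k e * w = w := by
    rw [hkm, sub_mul, add_mul, mul_assoc, h]; abel
  have hkz : cfcₙ k e ∈ pedZero A := by
    refine ⟨cfcₙ_nonneg fun t _ => le_max_left _ _, cfcₙ (fun t : ℝ => max 0 (min 1 (2 * t))) e,
      cfcₙ_nonneg fun t _ => le_max_left _ _, ?_⟩
    rw [← cfcₙ_mul (fun t : ℝ => max 0 (min 1 (2 * t))) k e (by fun_prop) (by simp)
      hk.continuousOn hk0]
    refine cfcₙ_congr fun t ht => ?_
    simp only [k]
    rcases le_total (2 * t - 1) 0 with h2 | h2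
    · rw [max_eq_left h2, mul_zero]
    · rw [max_eq_right h2, min_eq_left (by linarith), max_eq_right (by norm_num), one_mul]
  rw [← hkw]
  exact pedSpan_mul_mem (mem_pedSpan_of_mem_pedZero hkz) w

/-- Dominate `x x*` by `r² = ∑ bⱼ` with `bⱼ ∈ pedZero A`. Then `s* s = ∑ wⱼ* wⱼ` with `wⱼ = lim √bⱼ
gₙ s`, and each `wⱼ` inherits the local unit of `bⱼ`. -/
lemma star_mul_self_mem_pedSpan {x s : A} (hx : x ∈ pedSpan A) (hs : s ∈ rightIdeal x) :
    star s * s ∈ pedSpan A := by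
  obtain ⟨-, n, b, hb, hle⟩ := mem_pedPos_of_nonneg (pedSpan_mul_mem hx (star x))
    (mul_star_self_nonneg x)
  have hb0 : 0 ≤ ∑ j, b j := Finset.sum_nonneg fun j _ => (hb j).1
  set r := CFC.sqrt (∑ j, b j) with hr
  have hr0 : 0 ≤ r := CFC.sqrt_nonneg _
  have hrr : r * r = ∑ j, b j := CFC.sqrt_mul_sqrt_self _ hb0
  have hsr : s ∈ rightIdeal r := rightIdeal_le (mem_rightIdeal_of_mul_star_le hr0 (hrr ▸ hle)) hs
  obtain ⟨g, hg⟩ := exists_isQuasiInv hr0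
  have hsum : ∑ j, star (CFC.sqrt (b j)) * CFC.sqrt (b j) = r * r := by
    rw [hrr]
    refine Finset.sum_congr rfl fun j _ => ?_
    rw [(IsSelfAdjoint.of_nonneg (CFC.sqrt_nonneg (b j))).star_eq,
      CFC.sqrt_mul_sqrt_self _ (hb j).1]
  obtain ⟨w, hw, hws⟩ := hg.exists_sum_star_mul hr0 hsum hsr
  rw [← hws]
  refine Submodule.sum_mem _ fun j _ => mul_mem_pedSpan ?_ _
  obtain ⟨hbj, e, he0, he⟩ := hb j
  refine mem_pedSpan_of_mul_eq he0 ?_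
  have h1 : e * CFC.sqrt (b j) = CFC.sqrt (b j) := by
    have h2 := CFC.sqrt_mul_sqrt_self (b j) hbj
    have h3 : CFC.sqrt (b j) ∈ rightIdeal (b j) := by
      rw [← h2, CFC.sqrt_mul_self _ (CFC.sqrt_nonneg _)]
      exact self_mem_rightIdeal_mul_self (CFC.sqrt_nonneg _)
    refine closure_minimal (s := Set.range fun a : A => b j * a) (t := {y | e * y = y}) ?_
      (isClosed_eq (by fun_prop) continuous_id) h3
    rintro _ ⟨a, rfl⟩
    change e * (b j * a) = b j * a
    rw [← mul_assoc, he]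
  refine tendsto_nhds_unique ((hw j).const_mul e) ((hw j).congr fun n => ?_)
  rw [← mul_assoc e, h1]

/-- The Pedersen ideal contains the closed right ideals generated by its elements. -/
lemma mem_pedSpan_of_mem_rightIdeal {x c : A} (hx : x ∈ pedSpan A) (hc : c ∈ rightIdeal x) :
    c ∈ pedSpan A := by
  obtain ⟨r, w, hr0, hr, rfl⟩ := exists_nonneg_mul_eq c
  refine pedSpan_mul_mem ?_ w
  have h1 := CFC.sqrt_mul_sqrt_self r hr0
  have h2 : CFC.sqrt r ∈ rightIdeal r := by
    have := self_mem_rightIdeal_mul_self (CFC.sqrt_nonneg r)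
    rwa [h1] at this
  have h3 := star_mul_self_mem_pedSpan hx (rightIdeal_le hc (rightIdeal_le hr h2))
  rwa [(IsSelfAdjoint.of_nonneg (CFC.sqrt_nonneg r)).star_eq, h1] at h3

end Pedersen

/-! ### The hereditary cone generated by `X` -/

section SumCone

variable {A : Type*} [NonUnitalCStarAlgebra A]

/-- `p = ∑ cᵢ* cᵢ` with `cᵢ` in the closed right ideal generated by `xᵢ ∈ X`. -/
structure IsDecomp (X : Set A) (p : A) {n : ℕ} (x c : Fin n → A) : Prop where
  mem : ∀ i, x i ∈ X
  mem_rightIdeal : ∀ i, c i ∈ rightIdeal (x i)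
  sum_eq : ∑ i, star (c i) * c i = p

lemma IsDecomp.single {X : Set A} {x c : A} (hx : x ∈ X) (hc : c ∈ rightIdeal x) :
    IsDecomp X (star c * c) (fun _ : Fin 1 => x) fun _ => c :=
  ⟨fun _ => hx, fun _ => hc, by simp⟩

lemma IsDecomp.append {X : Set A} {p q : A} {n m : ℕ} {x c : Fin n → A} {y d : Fin m → A}
    (h : IsDecomp X p x c) (h' : IsDecomp X q y d) :
    IsDecomp X (p + q) (Fin.append x y) (Fin.append c d) := by
  refine ⟨fun i => ?_, fun i => ?_, by simp [Fin.sum_univ_add, h.sum_eq, h'.sum_eq]⟩ <;>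
    induction i using Fin.addCases with
    | left i => first | simpa using h.mem i | simpa using h.mem_rightIdeal i
    | right i => first | simpa using h'.mem i | simpa using h'.mem_rightIdeal i

lemma IsDecomp.mul {X : Set A} {p : A} {n : ℕ} {x c : Fin n → A}
    (h : IsDecomp X p x c) (v : A) : IsDecomp X (star v * p * v) x fun i => c i * v := by
  refine ⟨h.mem, fun i => rightIdeal_mul_mem (h.mem_rightIdeal i) v, ?_⟩
  rw [← h.sum_eq, Finset.mul_sum, Finset.sum_mul]
  simp [mul_assoc]

lemma IsDecomp.smul {X : Set A} {p : A} {n : ℕ} {x c : Fin n → A}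
    (h : IsDecomp X p x c) {r : ℝ} (hr : 0 ≤ r) :
    IsDecomp X ((r : ℂ) • p) x fun i => ((Real.sqrt r : ℝ) : ℂ) • c i := by
  refine ⟨h.mem, fun i => Submodule.smul_mem _ _ (h.mem_rightIdeal i), ?_⟩
  rw [← h.sum_eq, Finset.smul_sum]
  simp [star_smul, smul_mul_assoc, mul_smul_comm, smul_smul,
    Real.mul_self_sqrt hr]

/-- The cone of the finite sums `∑ cᵢ* cᵢ` with `cᵢ` in the closed right ideal generated by some
element of `X`. -/
def sumCone (X : Set A) : Set A := {p | ∃ (n : ℕ) (x c : Fin n → A), IsDecomp X p x c}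

lemma zero_mem_sumCone (X : Set A) : 0 ∈ sumCone X :=
  ⟨0, Fin.elim0, Fin.elim0, fun i => i.elim0, fun i => i.elim0, by simp⟩

lemma add_mem_sumCone {X : Set A} {p q : A} (hp : p ∈ sumCone X) (hq : q ∈ sumCone X) :
    p + q ∈ sumCone X := by
  obtain ⟨n, x, c, h⟩ := hp
  obtain ⟨m, y, d, h'⟩ := hq
  exact ⟨_, _, _, h.append h'⟩

lemma smul_mem_sumCone {X : Set A} {p : A} (hp : p ∈ sumCone X) {r : ℝ} (hr : 0 ≤ r) :
    (r : ℂ) • p ∈ sumCone X := by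
  obtain ⟨n, x, c, h⟩ := hp
  exact ⟨_, _, _, h.smul hr⟩

variable [PartialOrder A] [StarOrderedRing A]

lemma IsDecomp.nonneg {X : Set A} {p : A} {n : ℕ} {x c : Fin n → A} (h : IsDecomp X p x c) :
    0 ≤ p := by
  rw [← h.sum_eq]
  exact Finset.sum_nonneg fun i _ => star_mul_self_nonneg _

lemma IsDecomp.star_mul_le {X : Set A} {p : A} {n : ℕ} {x c : Fin n → A} (h : IsDecomp X p x c)
    (i : Fin n) : star (c i) * c i ≤ p := by
  rw [← h.sum_eq]
  exact Finset.single_le_sum (f := fun i => star (c i) * c i)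
    (fun i _ => star_mul_self_nonneg _) (Finset.mem_univ i)

lemma IsDecomp.norm_mul_star_le {X : Set A} {p : A} {n : ℕ} {x c : Fin n → A}
    (h : IsDecomp X p x c) (i : Fin n) : ‖c i * star (c i)‖ ≤ ‖p‖ := by
  rw [CStarRing.norm_self_mul_star, ← CStarRing.norm_star_mul_self]
  exact CStarAlgebra.norm_le_norm_of_nonneg_of_le (star_mul_self_nonneg _) (h.star_mul_le i)

/-- Take `wᵢ = lim cᵢ gₙ a`, formally `cᵢ p^(-1/2) a`. When `a a* = p`, the inner factors of `wᵢ
wᵢ*` cancel. This yields both heredity of the cone and traciality of the extended functional. -/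
lemma IsDecomp.exists_of_mul_star_le {X : Set A} {p a : A} {n : ℕ} {x c : Fin n → A}
    (h : IsDecomp X p x c) (ha : a * star a ≤ p) :
    ∃ w : Fin n → A, IsDecomp X (star a * a) x w ∧
      (a * star a = p → ∀ i, w i * star (w i) = c i * star (c i)) := by
  set r := CFC.sqrt p with hr
  have hr0 : 0 ≤ r := CFC.sqrt_nonneg _
  have hrr : r * r = p := CFC.sqrt_mul_sqrt_self _ h.nonneg
  have hrs : star r = r := (IsSelfAdjoint.of_nonneg hr0).star_eq
  obtain ⟨g, hg⟩ := exists_isQuasiInv hr0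
  obtain ⟨w, hw, hws⟩ := hg.exists_sum_star_mul hr0 (h.sum_eq.trans hrr.symm)
    (mem_rightIdeal_of_mul_star_le hr0 (hrr ▸ ha))
  refine ⟨w, ⟨h.mem, fun i => ?_, hws⟩, fun hap i => ?_⟩
  · exact (isClosed_rightIdeal _).mem_of_tendsto (hw i)
      (.of_forall fun n => rightIdeal_mul_mem (h.mem_rightIdeal i) _)
  · have h1 : star (c i) ∈ rightIdeal r := mem_rightIdeal_of_mul_star_le hr0
      (by rw [hrr, star_star]; exact h.star_mul_le i)
    have h2 := (hg.tendsto_of_mem h1).star.mul (hg.tendsto_of_mem h1)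
    rw [star_star] at h2
    refine tendsto_nhds_unique ((hw i).mul (hw i).star) (h2.congr fun n => ?_)
    have h3 : r * (r * (g n * star (c i))) = a * (star a * (g n * star (c i))) := by
      rw [← mul_assoc, hrr, ← hap, mul_assoc]
    simp only [star_mul, star_star, hrs, (hg.isSelfAdjoint n).star_eq, mul_assoc, h3]

lemma IsDecomp.exists_of_le {X : Set A} {p q : A} {n : ℕ} {x c : Fin n → A}
    (h : IsDecomp X p x c) (hq : 0 ≤ q) (hqp : q ≤ p) : ∃ w : Fin n → A, IsDecomp X q x w := by
  have h1 := CFC.sqrt_mul_sqrt_self q hq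
  have h2 := (IsSelfAdjoint.of_nonneg (CFC.sqrt_nonneg q)).star_eq
  obtain ⟨w, hw, -⟩ := h.exists_of_mul_star_le (a := CFC.sqrt q) (by rwa [h2, h1])
  rw [h2, h1] at hw
  exact ⟨w, hw⟩

lemma mem_sumCone_of_le {X : Set A} {p q : A} (hp : p ∈ sumCone X) (hq : 0 ≤ q) (h : q ≤ p) :
    q ∈ sumCone X := by
  obtain ⟨n, x, c, h'⟩ := hp
  obtain ⟨w, hw⟩ := h'.exists_of_le hq h
  exact ⟨_, _, _, hw⟩

/-- The ideal of the elements `a` with `a* a` in `sumCone X`. -/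
def sumIdeal (X : Set A) : Submodule ℂ A where
  carrier := {a | star a * a ∈ sumCone X}
  add_mem' {a b} ha hb := by
    have h1 := add_mem_sumCone ha hb
    refine mem_sumCone_of_le (add_mem_sumCone h1 h1) (star_mul_self_nonneg _) ?_
    have h2 : star a * a + star b * b + (star a * a + star b * b) - star (a + b) * (a + b)
        = star (a - b) * (a - b) := by
      simp only [star_add, star_sub, add_mul, mul_add, sub_mul, mul_sub]
      abel
    rw [← sub_nonneg, h2]
    exact star_mul_self_nonneg _
  zero_mem' := by simpa using zero_mem_sumCone X
  smul_mem' c a ha := by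
    have h1 := smul_mem_sumCone (X := X) ha (sq_nonneg ‖c‖)
    have h2 : star (c • a) * (c • a) = ((‖c‖ ^ 2 : ℝ) : ℂ) • (star a * a) := by
      simp only [star_smul, smul_mul_assoc, mul_smul_comm, smul_smul, Complex.star_def]
      rw [← Complex.normSq_eq_norm_sq, Complex.mul_conj]
    change star (c • a) * (c • a) ∈ sumCone X
    rwa [h2]

lemma sumIdeal_mul_mem {X : Set A} {a : A} (ha : a ∈ sumIdeal X) (b : A) :
    b * a ∈ sumIdeal X ∧ a * b ∈ sumIdeal X := by
  constructor
  · refine mem_sumCone_of_le (smul_mem_sumCone (X := X) ha (norm_nonneg (star b * b)))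
      (star_mul_self_nonneg _) ?_
    have := CStarAlgebra.star_left_conjugate_le_norm_smul (a := a) (b := star b * b)
    simpa [mul_assoc, Complex.coe_smul] using this
  · obtain ⟨n, x, c, h⟩ := ha
    have h1 : star b * (star a * a) * b = star (a * b) * (a * b) := by simp [mul_assoc]
    exact ⟨_, _, _, h1 ▸ h.mul b⟩

/-- The closure of `sumIdeal X` is a closed ideal containing `X`, hence all of `A`. The passage from
dense to exact uses the local unit: if `e a = a` and `f` in the cone is within `1/2` of `e²`, then
`a ≤ 2 √a f √a`. -/
lemma pedPos_subset_sumCone {X : Set A} (hX : ∀ I : Submodule ℂ A, IsClosed (I : Set A) →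
      (∀ a b : A, b ∈ I → a * b ∈ I ∧ b * a ∈ I) → X ⊆ I → I = ⊤) :
    pedPos A ⊆ sumCone X := by
  have hI : (sumIdeal X).topologicalClosure = ⊤ := by
    refine hX _ (Submodule.isClosed_topologicalClosure _) (fun a b hb => ⟨?_, ?_⟩) fun x hx => ?_
    · exact map_mem_closure (f := fun b => a * b) (by fun_prop) hb
        fun b hb => (sumIdeal_mul_mem hb a).1
    · exact map_mem_closure (f := fun b => b * a) (by fun_prop) hb
        fun b hb => (sumIdeal_mul_mem hb a).2
    · exact Submodule.le_topologicalClosure _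
        ⟨_, _, _, IsDecomp.single hx (self_mem_rightIdeal x)⟩
  have hz : pedZero A ⊆ sumCone X := by
    rintro a ⟨ha, e, he0, he⟩
    have hes := (IsSelfAdjoint.of_nonneg he0).star_eq
    have hcl : e * e ∈ closure (sumCone X) := by
      have h1 : e ∈ (sumIdeal X).topologicalClosure := hI ▸ Submodule.mem_top
      have := map_mem_closure (f := fun b : A => star b * b) (by fun_prop) h1
        (t := sumCone X) fun b hb => hb
      simpa [hes] using this
    obtain ⟨f, hf, hfe⟩ := Metric.mem_closure_iff.mp hcl (1 / 2) (by norm_num)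
    set s := CFC.sqrt a with hs
    have hs0 : 0 ≤ s := CFC.sqrt_nonneg _
    have hss : s * s = a := CFC.sqrt_mul_sqrt_self _ ha
    have hst : star s = s := (IsSelfAdjoint.of_nonneg hs0).star_eq
    have hae : a * e = a := by
      have := congrArg star he
      rwa [star_mul, hes, (IsSelfAdjoint.of_nonneg ha).star_eq] at this
    have hes' : e * s = s := by
      rw [← sub_eq_zero, ← CStarRing.mul_star_self_eq_zero_iff, star_sub, star_mul, hst, hes]
      simp only [sub_mul, mul_sub, ← mul_assoc]
      simp [mul_assoc, hss, hae, he]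
    have h1 : a - s * f * s ≤ ((1 / 2 : ℝ) : ℂ) • a := by
      have hfsa : IsSelfAdjoint f := by
        obtain ⟨n, x, c, h⟩ := hf
        exact .of_nonneg h.nonneg
      have h2 : IsSelfAdjoint (e * e - f) := by
        refine IsSelfAdjoint.sub ?_ hfsa
        simp [IsSelfAdjoint, hes]
      have h3 := CStarAlgebra.star_left_conjugate_le_norm_smul (a := s) h2
      have h4 : star s * (e * e - f) * s = a - s * f * s := by
        rw [hst, mul_sub, sub_mul]
        congr 1
        rw [mul_assoc, mul_assoc, hes', hes', hss]
      rw [h4, hst, hss] at h3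
      refine h3.trans ?_
      rw [Complex.coe_smul]
      rw [dist_eq_norm] at hfe
      rw [← sub_nonneg, ← sub_smul]
      exact smul_nonneg (by linarith) ha
    have h5 : a ≤ ((2 : ℝ) : ℂ) • (s * f * s) := by
      have h6 := ofReal_smul_nonneg zero_le_two (sub_nonneg.mpr h1)
      rw [← sub_nonneg]
      convert h6 using 1
      push_cast
      module
    obtain ⟨n, x, c, h⟩ := hf
    have h7 := h.mul s
    rw [hst] at h7
    exact mem_sumCone_of_le (smul_mem_sumCone ⟨_, _, _, h7⟩ zero_le_two) ha h5
  rintro a ⟨ha, n, b, hb, hab⟩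
  refine mem_sumCone_of_le ?_ ha hab
  exact Finset.sum_induction _ (· ∈ sumCone X) (fun _ _ => add_mem_sumCone) (zero_mem_sumCone X)
    fun j _ => hz (hb j)

end SumCone

/-! ### Polarization in `*`-algebras -/

section Polarization

variable {B : Type*} [NonUnitalRing B] [StarRing B] [Module ℂ B] [IsScalarTower ℂ B B]
  [SMulCommClass ℂ B B] [StarModule ℂ B]

lemma star_mul_polarization (x y : B) :
    star x * y = (1 / 4 : ℂ) • (star (x + y) * (x + y) - star (x - y) * (x - y)
      - Complex.I • (star (x + Complex.I • y) * (x + Complex.I • y)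
      - star (x - Complex.I • y) * (x - Complex.I • y))) := by
  simp only [star_add, star_sub, star_smul, add_mul, mul_add, sub_mul, mul_sub, smul_mul_assoc,
    mul_smul_comm, smul_add, smul_sub, smul_smul, Complex.star_def, Complex.conj_I]
  ring_nf
  simp only [Complex.I_sq]
  module

lemma mul_star_polarization (x y : B) :
    y * star x = (1 / 4 : ℂ) • ((x + y) * star (x + y) - (x - y) * star (x - y)
      - Complex.I • ((x + Complex.I • y) * star (x + Complex.I • y)
      - (x - Complex.I • y) * star (x - Complex.I • y))) := by
  simp only [star_add, star_sub, star_smul, add_mul, mul_add, sub_mul, mul_sub, smul_mul_assoc,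
    mul_smul_comm, smul_add, smul_sub, smul_smul, Complex.star_def, Complex.conj_I]
  ring_nf
  simp only [Complex.I_sq]
  module

lemma map_mul_comm_of_star_mul_self {τ : B →ₗ[ℂ] ℂ}
    (h : ∀ z, τ (star z * z) = τ (z * star z)) (x y : B) : τ (x * y) = τ (y * x) := by
  have h1 := star_mul_polarization (star x) y
  have h2 := mul_star_polarization (star x) y
  rw [star_star] at h1 h2
  rw [h1, h2]
  simp only [map_smul, map_sub, h]

lemma linearMap_eq_of_mul_star_self {τ σ : B →ₗ[ℂ] ℂ}
    (h : ∀ z, τ (z * star z) = σ (z * star z)) (x y : B) : τ (x * y) = σ (x * y) := by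
  have h1 := mul_star_polarization (star y) x
  rw [star_star] at h1
  rw [h1]
  simp only [map_smul, map_sub, h]

end Polarization

/-! ### Continuity for the direct limit topology -/

section Bounded

variable {A : Type*} [NonUnitalCStarAlgebra A] [PartialOrder A] [StarOrderedRing A]

/-- Gliding hump: were `τ` unbounded on the positive part of `D`, suitable multiples of bad elements
would sum to one element of `D ⊆ Ped A` dominating them all, against the bound below it. -/
lemma exists_bound_of_dominated {τ : Ped A →ₗ[ℂ] ℂ}
    (h : ∀ p ∈ pedPos A, ∃ M : ℝ, ∀ q : Ped A, 0 ≤ (q : A) → (q : A) ≤ p → ‖τ q‖ ≤ M * ‖(q : A)‖)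
    {D : NonUnitalStarSubalgebra ℂ A} (hD : D ≤ Ped A) (hDc : IsClosed (D : Set A)) :
    ∃ C : ℝ, 0 ≤ C ∧ ∀ q : D, 0 ≤ (q : A) →
      ‖τ (NonUnitalStarSubalgebra.inclusion hD q)‖ ≤ C * ‖(q : A)‖ := by
  by_contra! hcon
  choose q hq0 hq using fun n : ℕ => hcon (4 ^ n) (by positivity)
  have hpos : ∀ n, 0 < ‖(q n : A)‖ := fun n => by
    rw [norm_pos_iff]
    intro h0
    have h1 : q n = 0 := Subtype.ext h0
    have := hq n
    simp [h1] at this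
  -- Scaled to norm `2⁻ⁿ` for summability; the ratio `4ⁿ` is scale invariant.
  let s : ℕ → ℝ := fun n => (2 ^ n * ‖(q n : A)‖)⁻¹
  have hs : ∀ n, 0 < s n := fun n => inv_pos.mpr (mul_pos (by positivity) (hpos n))
  let p : ℕ → D := fun n => (s n : ℂ) • q n
  have hp0 : ∀ n, 0 ≤ (p n : A) := fun n => ofReal_smul_nonneg (hs n).le (hq0 n)
  have hpn : ∀ n, ‖(p n : A)‖ = (1 / 2) ^ n := fun n => by
    have : (p n : A) = (s n : ℂ) • (q n : A) := rfl
    rw [this, norm_smul, Complex.norm_real, Real.norm_of_nonneg (hs n).le]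
    have := hpos n
    simp only [s]
    rw [one_div, inv_pow]
    field_simp
  have hpτ : ∀ n, 4 ^ n * ‖(p n : A)‖ < ‖τ (NonUnitalStarSubalgebra.inclusion hD (p n))‖ := by
    intro n
    have h1 : (p n : A) = (s n : ℂ) • (q n : A) := rfl
    have h2 : NonUnitalStarSubalgebra.inclusion hD (p n)
        = (s n : ℂ) • NonUnitalStarSubalgebra.inclusion hD (q n) := map_smul _ _ _
    rw [h1, h2, map_smul, norm_smul, norm_smul, Complex.norm_real, Real.norm_of_nonneg (hs n).le,
      mul_left_comm]
    exact mul_lt_mul_of_pos_left (hq n) (hs n)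
  have hsum : Summable fun n => (p n : A) := by
    refine Summable.of_norm ?_
    simp only [hpn]
    exact summable_geometric_of_lt_one (by norm_num) (by norm_num)
  have hmem : (∑' n, (p n : A)) ∈ D :=
    hDc.mem_of_tendsto hsum.hasSum (.of_forall fun t => sum_mem fun n _ => (p n).2)
  have hle : ∀ n, (p n : A) ≤ ∑' n, (p n : A) := fun n =>
    le_hasSum hsum.hasSum n fun j _ => hp0 j
  obtain ⟨M, hM⟩ := h _ (mem_pedPos_of_nonneg (hD hmem) (tsum_nonneg hp0))
  obtain ⟨n, hn⟩ := pow_unbounded_of_one_lt M (show (1 : ℝ) < 4 by norm_num)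
  have h1 := (hpτ n).trans_le (hM (NonUnitalStarSubalgebra.inclusion hD (p n)) (hp0 n) (hle n))
  have h2 : 0 < ‖(p n : A)‖ := by rw [hpn]; positivity
  exact absurd (lt_of_mul_lt_mul_right h1 h2.le) hn.not_gt

lemma continuous_comp_inclusion_of_dominated {τ : Ped A →ₗ[ℂ] ℂ}
    (h : ∀ p ∈ pedPos A, ∃ M : ℝ, ∀ q : Ped A, 0 ≤ (q : A) → (q : A) ≤ p → ‖τ q‖ ≤ M * ‖(q : A)‖)
    {D : NonUnitalStarSubalgebra ℂ A} (hD : D ≤ Ped A) (hDc : IsClosed (D : Set A)) :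
    Continuous fun d : D => τ (NonUnitalStarSubalgebra.inclusion hD d) := by
  obtain ⟨C, hC0, hC⟩ := exists_bound_of_dominated h hD hDc
  let f : D →ₗ[ℂ] ℂ := τ ∘ₗ (NonUnitalStarSubalgebra.inclusion hD : D →ₗ[ℂ] Ped A)
  have hf0 : ∀ q : D, 0 ≤ (q : A) → ‖f q‖ ≤ C * ‖(q : A)‖ := hC
  have hf1 : ∀ b : D, IsSelfAdjoint (b : A) → ‖f b‖ ≤ 2 * C * ‖(b : A)‖ := by
    intro b hb
    have hp : (b : A)⁺ ∈ D := cfcₙ_mem (𝕜' := ℂ) (hs := hDc) _ b.2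
    have hn : (b : A)⁻ ∈ D := cfcₙ_mem (𝕜' := ℂ) (hs := hDc) _ b.2
    have h1 : b = ⟨_, hp⟩ - ⟨_, hn⟩ := Subtype.ext (CFC.posPart_sub_negPart (b : A) hb).symm
    have h2 := hf0 ⟨_, hp⟩ (CFC.posPart_nonneg _)
    have h3 := hf0 ⟨_, hn⟩ (CFC.negPart_nonneg _)
    have h4 := mul_le_mul_of_nonneg_left (CStarAlgebra.norm_posPart_le (b : A)) hC0
    have h5 := mul_le_mul_of_nonneg_left (CStarAlgebra.norm_negPart_le (b : A)) hC0
    have h6 : ‖f b‖ ≤ ‖f ⟨_, hp⟩‖ + ‖f ⟨_, hn⟩‖ := by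
      rw [congrArg f h1, map_sub]
      exact norm_sub_le _ _
    dsimp only at h2 h3
    linarith
  refine (f.mkContinuous (4 * C) fun b => ?_).continuous
  -- Real and imaginary parts, both in the form `c + c*`, for `c = b` and `c = i b`, so that `key`
  -- serves for both.
  have hb : b = (1 / 2 : ℂ) • (b + star b)
      - (Complex.I / 2) • (Complex.I • b + star (Complex.I • b)) := by
    rw [star_smul, Complex.star_def, Complex.conj_I]
    simp only [smul_add, smul_smul]
    rw [div_mul_eq_mul_div, Complex.I_mul_I, mul_neg, div_mul_eq_mul_div, Complex.I_mul_I]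
    module
  have key : ∀ c : D, ‖f (c + star c)‖ ≤ 4 * C * ‖(c : A)‖ := fun c => by
    have h1 := hf1 (c + star c) (by
      change IsSelfAdjoint ((c : A) + star (c : A))
      exact IsSelfAdjoint.add_star_self _)
    have h2 : ‖((c + star c : D) : A)‖ ≤ 2 * ‖(c : A)‖ := by
      change ‖(c : A) + star (c : A)‖ ≤ _
      have := norm_add_le (c : A) (star (c : A))
      rw [norm_star] at this
      linarith
    nlinarith
  have h1 := key b
  have h2 := key (Complex.I • b)
  have h3 : ‖((Complex.I • b : D) : A)‖ = ‖(b : A)‖ := by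
    change ‖Complex.I • (b : A)‖ = _
    rw [norm_smul, Complex.norm_I, one_mul]
  rw [h3] at h2
  have h4 : ‖f b‖ ≤ 1 / 2 * ‖f (b + star b)‖
      + 1 / 2 * ‖f (Complex.I • b + star (Complex.I • b))‖ := by
    nth_rewrite 1 [hb]
    rw [map_sub, map_smul, map_smul]
    refine (norm_sub_le _ _).trans_eq ?_
    simp
  change ‖f b‖ ≤ 4 * C * ‖(b : A)‖
  linarith

/-- The topology induced by `τ` is itself one of the topologies in the infimum. -/
lemma continuous_pedTopology {τ : Ped A →ₗ[ℂ] ℂ}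
    (h : ∀ (D : NonUnitalStarSubalgebra ℂ A) (hD : D ≤ Ped A), IsClosed (D : Set A) →
      Continuous fun d : D => τ (NonUnitalStarSubalgebra.inclusion hD d)) :
    Continuous[pedTopology A, inferInstance] τ := by
  rw [continuous_iff_le_induced]
  refine sInf_le ⟨topologicalAddGroup_induced τ, continuousSMul_induced τ,
    LocallyConvexSpace.induced (𝕜 := ℝ) (τ.restrictScalars ℝ), fun D hD hDc => ?_⟩
  exact continuous_induced_rng.mpr (h D hD hDc)

lemma continuous_inclusion_of_mem_TR {τ : Ped A →ₗ[ℂ] ℂ} (hτ : τ ∈ TR A)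
    {D : NonUnitalStarSubalgebra ℂ A} (hD : D ≤ Ped A) (hDc : IsClosed (D : Set A)) :
    Continuous fun d : D => τ (NonUnitalStarSubalgebra.inclusion hD d) := by
  have h1 : Continuous[inferInstance, pedTopology A] (NonUnitalStarSubalgebra.inclusion hD) :=
    continuous_sInf_rng.mpr fun t ht => ht.2.2.2 D hD hDc
  exact @Continuous.comp _ _ _ _ (pedTopology A) _ _ _ hτ.1 h1

end Bounded

/-! ### Extending compatible corner traces to the Pedersen ideal -/

section Extension

variable {A : Type*} [NonUnitalCStarAlgebra A]

/-- A family of bounded functionals whose restrictions to the closures of `x A x*`, `x ∈ X`, are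
self-adjoint and satisfy the trace identity on the closures of `x A y*`. -/
structure IsTraceFamily (X : Set A) (φ : A → A →L[ℂ] ℂ) : Prop where
  map_star : ∀ x ∈ X, ∀ z ∈ closure (Set.range fun a : A => x * a * star x),
    φ x (star z) = star (φ x z)
  map_mul_star : ∀ x ∈ X, ∀ y ∈ X, ∀ z ∈ closure (Set.range fun a : A => x * a * star y),
    φ x (z * star z) = φ y (star z * z)

/-- The pairs consisting of `∑ cᵢ* cᵢ` and `∑ φ xᵢ (cᵢ cᵢ*)`, with `cᵢ` in the closed right ideal
generated by `xᵢ ∈ X`. -/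
def decompGraph (X : Set A) (φ : A → A →L[ℂ] ℂ) : Set (A × ℂ) :=
  {p | ∃ (n : ℕ) (x c : Fin n → A), IsDecomp X p.1 x c ∧ p.2 = ∑ i, φ (x i) (c i * star (c i))}

lemma zero_mem_decompGraph (X : Set A) (φ : A → A →L[ℂ] ℂ) : 0 ∈ decompGraph X φ :=
  ⟨0, Fin.elim0, Fin.elim0, ⟨fun i => i.elim0, fun i => i.elim0, by simp⟩, by simp⟩

lemma add_mem_decompGraph {X : Set A} {φ : A → A →L[ℂ] ℂ} {p q : A × ℂ}
    (hp : p ∈ decompGraph X φ) (hq : q ∈ decompGraph X φ) : p + q ∈ decompGraph X φ := by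
  obtain ⟨n, x, c, h, hp⟩ := hp
  obtain ⟨m, y, d, h', hq⟩ := hq
  exact ⟨_, _, _, h.append h', by simp [Fin.sum_univ_add, hp, hq]⟩

lemma smul_mem_decompGraph {X : Set A} {φ : A → A →L[ℂ] ℂ} {p : A × ℂ}
    (hp : p ∈ decompGraph X φ) {r : ℝ} (hr : 0 ≤ r) : (r : ℂ) • p ∈ decompGraph X φ := by
  obtain ⟨n, x, c, h, hp⟩ := hp
  refine ⟨_, _, _, h.smul hr, ?_⟩
  rw [Prod.smul_snd, hp, Finset.smul_sum]
  refine Finset.sum_congr rfl fun i _ => ?_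
  rw [star_smul, smul_mul_smul_comm, map_smul, Complex.star_def, Complex.conj_ofReal,
    ← Complex.ofReal_mul, Real.mul_self_sqrt hr]

variable [PartialOrder A] [StarOrderedRing A] {X : Set A} {φ : A → A →L[ℂ] ℂ}

/-- The value of `∑ φ xᵢ (cᵢ cᵢ*)` depends on `∑ cᵢ* cᵢ` only. -/
lemma IsTraceFamily.sum_eq_sum (hφ : IsTraceFamily X φ) {p : A} {n m : ℕ} {x c : Fin n → A}
    {y d : Fin m → A} (h : IsDecomp X p x c) (h' : IsDecomp X p y d) :
    ∑ i, φ (x i) (c i * star (c i)) = ∑ j, φ (y j) (d j * star (d j)) := by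
  set r := CFC.sqrt p with hr
  have hr0 : 0 ≤ r := CFC.sqrt_nonneg _
  have hrr : r * r = p := CFC.sqrt_mul_sqrt_self _ h.nonneg
  obtain ⟨g, hg⟩ := exists_isQuasiInv hr0
  have hc : ∀ i, star (c i) ∈ rightIdeal r := fun i => mem_rightIdeal_of_mul_star_le hr0
    (by rw [hrr, star_star]; exact h.star_mul_le i)
  have hd : ∀ j, star (d j) ∈ rightIdeal r := fun j => mem_rightIdeal_of_mul_star_le hr0
    (by rw [hrr, star_star]; exact h'.star_mul_le j)
  -- The refinement matrix: `z j i` stands for `cᵢ r⁻¹ dⱼ*`, and `z' i j` for its adjoint.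
  choose z hz hzs using fun j => hg.exists_sum_star_mul hr0 (h.sum_eq.trans hrr.symm) (hd j)
  choose z' hz' hzs' using fun i => hg.exists_sum_star_mul hr0 (h'.sum_eq.trans hrr.symm) (hc i)
  have hzz : ∀ i j, z' i j = star (z j i) := fun i j => by
    refine tendsto_nhds_unique (hz' i j) ((hz j i).star.congr fun n => ?_)
    simp [(hg.isSelfAdjoint n).star_eq, mul_assoc]
  have hmem : ∀ i j, z j i ∈ closure (Set.range fun a : A => x i * a * star (y j)) := fun i j => by
    refine isClosed_closure.mem_of_tendsto (hz j i) (.of_forall fun n => ?_)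
    rw [← mul_assoc]
    exact mul_star_mem_closure (rightIdeal_mul_mem (h.mem_rightIdeal i) _) (h'.mem_rightIdeal j)
  calc ∑ i, φ (x i) (c i * star (c i)) = ∑ i, ∑ j, φ (x i) (z j i * star (z j i)) := by
        refine Finset.sum_congr rfl fun i _ => ?_
        have := hzs' i
        rw [star_star] at this
        rw [← this, map_sum]
        simp only [hzz, star_star]
    _ = ∑ j, ∑ i, φ (y j) (star (z j i) * z j i) := by
        rw [Finset.sum_comm]
        exact Finset.sum_congr rfl fun j _ => Finset.sum_congr rfl fun i _ =>
          hφ.map_mul_star _ (h.mem i) _ (h'.mem j) _ (hmem i j)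
    _ = ∑ j, φ (y j) (d j * star (d j)) := by
        refine Finset.sum_congr rfl fun j _ => ?_
        have := hzs j
        rw [star_star] at this
        rw [← this, map_sum]

/-- This makes the span of `decompGraph X φ` the graph of a linear map. -/
lemma IsTraceFamily.snd_eq_zero (hφ : IsTraceFamily X φ) {p : A × ℂ}
    (hp : p ∈ Submodule.span ℂ (decompGraph X φ)) (h0 : p.1 = 0) : p.2 = 0 := by
  obtain ⟨p₁, ⟨n₁, x₁, c₁, h₁, e₁⟩, p₂, ⟨n₂, x₂, c₂, h₂, e₂⟩, p₃, ⟨n₃, x₃, c₃, h₃, e₃⟩, p₄,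
    ⟨n₄, x₄, c₄, h₄, e₄⟩, rfl⟩ := exists_eq_of_mem_span_cone (zero_mem_decompGraph X φ)
    (fun _ hx _ hy => add_mem_decompGraph hx hy) (fun _ hr _ hx => smul_mem_decompGraph hx hr) hp
  obtain ⟨h5, h6⟩ := eq_and_eq_of_sub_add_I_smul_eq_zero (.of_nonneg h₁.nonneg)
    (.of_nonneg h₂.nonneg) (.of_nonneg h₃.nonneg) (.of_nonneg h₄.nonneg) h0
  have h7 : p₁.2 = p₂.2 := by rw [e₁, e₂]; exact hφ.sum_eq_sum (h5 ▸ h₁) h₂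
  have h8 : p₃.2 = p₄.2 := by rw [e₃, e₄]; exact hφ.sum_eq_sum (h6 ▸ h₃) h₄
  simp [h7, h8]

lemma IsTraceFamily.exists_linearMap (hφ : IsTraceFamily X φ) (hX : pedPos A ⊆ sumCone X) :
    ∃ τ : Ped A →ₗ[ℂ] ℂ, ∀ (p : Ped A) (n : ℕ) (x c : Fin n → A), IsDecomp X (p : A) x c →
      τ p = ∑ i, φ (x i) (c i * star (c i)) := by
  set G := Submodule.span ℂ (decompGraph X φ) with hG
  have hG0 : ∀ p ∈ G, p.1 = 0 → p.2 = 0 := fun p hp h0 => hφ.snd_eq_zero hp h0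
  have hdom : pedSpan A ≤ G.map (LinearMap.fst ℂ A ℂ) := by
    refine Submodule.span_le.mpr fun p hp => ?_
    obtain ⟨n, x, c, h⟩ := hX hp
    exact ⟨(p, _), Submodule.subset_span ⟨n, x, c, h, rfl⟩, rfl⟩
  let ι : Ped A →ₗ[ℂ] G.map (LinearMap.fst ℂ A ℂ) :=
    { toFun := fun a => ⟨a, hdom a.2⟩
      map_add' := fun _ _ => rfl
      map_smul' := fun _ _ => rfl }
  refine ⟨G.toLinearPMap.toFun ∘ₗ ι, fun p n x c h => ?_⟩
  have h1 := G.mem_graph_toLinearPMap hG0 (ι p)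
  have h2 : ((p : A), ∑ i, φ (x i) (c i * star (c i))) ∈ G :=
    Submodule.subset_span ⟨n, x, c, h, rfl⟩
  exact sub_eq_zero.mp (hG0 _ (G.sub_mem h1 h2) (sub_self (p : A)))

/-- A compatible family of bounded traces on the corners given by `X` extends to a trace on the
Pedersen ideal. -/
lemma IsTraceFamily.exists_mem_TR (hφ : IsTraceFamily X φ) (hX : pedPos A ⊆ sumCone X) :
    ∃ τ ∈ TR A, ∀ (p : Ped A) (n : ℕ) (x c : Fin n → A), IsDecomp X (p : A) x c →
      τ p = ∑ i, φ (x i) (c i * star (c i)) := by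
  obtain ⟨τ, hτ⟩ := hφ.exists_linearMap hX
  refine ⟨τ, ⟨continuous_pedTopology fun D hD hDc =>
    continuous_comp_inclusion_of_dominated ?_ hD hDc, fun a => ?_,
    map_mul_comm_of_star_mul_self fun a => ?_⟩, hτ⟩
  · intro p hp
    obtain ⟨n, x, c, h⟩ := hX hp
    refine ⟨∑ i, ‖φ (x i)‖, fun q hq0 hqp => ?_⟩
    -- The decomposition of `q` uses the same `xᵢ` as that of `p`, so the constant `∑ ‖φ xᵢ‖`
    -- depends on `p` only.
    obtain ⟨w, hw⟩ := h.exists_of_le hq0 hqp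
    rw [hτ q n x w hw, Finset.sum_mul]
    refine (norm_sum_le _ _).trans (Finset.sum_le_sum fun i _ => ?_)
    exact ((φ (x i)).le_opNorm _).trans
      (mul_le_mul_of_nonneg_left (hw.norm_mul_star_le i) (norm_nonneg _))
  · obtain ⟨a, ha⟩ := a
    have ha' : a ∈ pedSpan A := ha
    induction ha' using Submodule.span_induction with
    | mem p hp =>
      have h1 : star (⟨p, ha⟩ : Ped A) = ⟨p, ha⟩ :=
        Subtype.ext (IsSelfAdjoint.of_nonneg hp.1).star_eq
      obtain ⟨n, x, c, h⟩ := hX hp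
      rw [h1, hτ ⟨p, ha⟩ n x c h, star_sum]
      refine Finset.sum_congr rfl fun i _ => ?_
      rw [← hφ.map_star _ (h.mem i) _
        (mul_star_mem_closure (h.mem_rightIdeal i) (h.mem_rightIdeal i)), star_mul, star_star]
    | zero =>
      have h1 : (⟨0, ha⟩ : Ped A) = 0 := rfl
      simp [h1]
    | add a b ha1 hb1 iha ihb =>
      have h1 : (⟨a + b, ha⟩ : Ped A) = ⟨a, ha1⟩ + ⟨b, hb1⟩ := rfl
      rw [h1, star_add, map_add, map_add, iha ha1, ihb hb1, star_add]
    | smul r a ha1 iha =>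
      have h1 : (⟨r • a, ha⟩ : Ped A) = r • ⟨a, ha1⟩ := rfl
      rw [h1, star_smul, map_smul, map_smul, iha ha1, star_smul]
  · have h0 : (a : A) * star (a : A) ∈ pedPos A :=
      mem_pedPos_of_nonneg (a * star a).2 (mul_star_self_nonneg _)
    obtain ⟨n, x, c, h⟩ := hX h0
    obtain ⟨w, hw, hwc⟩ := h.exists_of_mul_star_le le_rfl
    rw [hτ (star a * a) n x w hw, hτ (a * star a) n x c h]
    exact Finset.sum_congr rfl fun i _ => by rw [hwc rfl i]

end Extension

/-! ### Bounded functionals on corners -/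

section Corner

variable {A : Type*} [NonUnitalCStarAlgebra A]

/-- The hereditary `C*`-subalgebra `closure (x A x*)`. -/
def cornerAlgebra (x : A) : NonUnitalStarSubalgebra ℂ A :=
  NonUnitalStarSubalgebra.topologicalClosure
    { carrier := Set.range fun a : A => x * a * star x
      add_mem' := by
        rintro _ _ ⟨a, rfl⟩ ⟨b, rfl⟩
        exact ⟨a + b, by simp [mul_add, add_mul]⟩
      zero_mem' := ⟨0, by simp⟩
      mul_mem' := by
        rintro _ _ ⟨a, rfl⟩ ⟨b, rfl⟩
        exact ⟨a * star x * x * b, by simp [mul_assoc]⟩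
      smul_mem' := by
        rintro c _ ⟨a, rfl⟩
        exact ⟨c • a, by simp [mul_smul_comm, smul_mul_assoc]⟩
      star_mem' := by
        rintro _ ⟨a, rfl⟩
        exact ⟨star a, by simp [mul_assoc]⟩ }

lemma mem_cornerAlgebra_iff {x a : A} :
    a ∈ cornerAlgebra x ↔ a ∈ closure (Set.range fun a : A => x * a * star x) := Iff.rfl

lemma corner_mem_cornerAlgebra {A₀ : NonUnitalStarSubalgebra ℂ A} (x b : A₀) :
    (corner x b : A) ∈ cornerAlgebra (x : A) :=
  subset_closure ⟨(b : A), rfl⟩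

lemma star_corner {A₀ : NonUnitalStarSubalgebra ℂ A} (x b : A₀) :
    star (corner x b) = corner x (star b) := by
  simp [corner, mul_assoc]

lemma mul_mul_star_mul {A₀ : NonUnitalStarSubalgebra ℂ A} (x b : A₀) :
    (x * b) * star (x * b) = corner x (b * star b) := by
  simp [corner, mul_assoc]

/-- A functional that is bounded on `x A₀ x*` agrees there with a bounded functional on `A`. -/
lemma exists_clm_of_mem_TR₀ {A₀ : NonUnitalStarSubalgebra ℂ A} {X : Set A₀} {τ : A₀ →ₗ[ℂ] ℂ}
    (hτ : τ ∈ TR₀ A₀ X) {x : A₀} (hx : x ∈ X) :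
    ∃ φ : A →L[ℂ] ℂ, ∀ b : A₀, φ (corner x b) = τ (corner x b) := by
  obtain ⟨C, hC⟩ := hτ.2.2 x hx
  let ι : A₀ →ₗ[ℂ] A :=
    { toFun := fun a => a
      map_add' := fun _ _ => rfl
      map_smul' := fun _ _ => rfl }
  let S : Submodule ℂ A₀ :=
    LinearMap.range (LinearMap.mulRight ℂ (star x) ∘ₗ LinearMap.mulLeft ℂ x)
  let e := Submodule.equivMapOfInjective ι Subtype.val_injective S
  let f : S.map ι →ₗ[ℂ] ℂ := τ ∘ₗ S.subtype ∘ₗ e.symm.toLinearMap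
  have hf : ∀ w, ‖f w‖ ≤ C * ‖w‖ := fun w => by
    obtain ⟨⟨_, b, rfl⟩, rfl⟩ := e.surjective w
    simp only [f, LinearMap.comp_apply, LinearEquiv.coe_coe, LinearEquiv.symm_apply_apply]
    exact hC b
  -- Hahn–Banach; the values of `φ` off the closed corner are arbitrary and play no role.
  obtain ⟨φ, hφ, -⟩ := exists_extension_norm_eq (S.map ι) (f.mkContinuous C hf)
  refine ⟨φ, fun b => ?_⟩
  have h1 : corner x b ∈ S := ⟨b, rfl⟩
  have h2 := hφ (e ⟨corner x b, h1⟩)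
  have h3 : ((e ⟨corner x b, h1⟩ : S.map ι) : A) = (corner x b : A) := rfl
  rw [h3] at h2
  rw [h2]
  simp [f]

/-- The evaluation functionals that define the topology of `T_ℝ(A₀, X)`. -/
def evalFunctionals {A₀ : NonUnitalStarSubalgebra ℂ A} (X : Set A₀) : Set (TR₀ A₀ X → ℂ) :=
  {F | ∃ x ∈ X, ∃ a ∈ cornerAlgebra (x : A), F = fun τ : TR₀ A₀ X => extEval x a τ}

lemma continuous_of_mem_span_evalFunctionals {A₀ : NonUnitalStarSubalgebra ℂ A} {X : Set A₀}
    {F : TR₀ A₀ X → ℂ}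
    (hF : F ∈ Submodule.span ℂ (evalFunctionals X)) : Continuous F := by
  induction hF using Submodule.span_induction with
  | mem F hF =>
    obtain ⟨x, hx, a, ha, rfl⟩ := hF
    exact continuous_iInf_dom (i := x) <| continuous_iInf_dom (i := hx) <|
      continuous_iInf_dom (i := a) <| continuous_iInf_dom (i := ha) continuous_induced_dom
  | zero => exact continuous_const
  | add F G _ _ hF hG => exact hF.add hG
  | smul c F _ hF => exact hF.const_smul c

lemma exists_isTraceFamily {A₀ : NonUnitalStarSubalgebra ℂ A} {X : Set A₀} {τ : A₀ →ₗ[ℂ] ℂ}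
    (hτ : τ ∈ TR₀ A₀ X)
    (hdense : ∀ x ∈ X, ∀ y ∈ X,
      closure (Set.range fun a : A₀ => (x : A) * (a : A) * star (y : A)) =
        closure (Set.range fun a : A => (x : A) * a * star (y : A))) :
    ∃ φ : A → A →L[ℂ] ℂ, IsTraceFamily ((↑) '' X : Set A) φ ∧
      ∀ x ∈ X, ∀ b : A₀, φ x (corner x b) = τ (corner x b) := by
  have h1 : ∀ a : A, ∃ φ : A →L[ℂ] ℂ, ∀ x ∈ X, (x : A) = a → ∀ b : A₀,
      φ (corner x b) = τ (corner x b) := fun a => by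
    by_cases h : ∃ x ∈ X, (x : A) = a
    · obtain ⟨x, hx, rfl⟩ := h
      obtain ⟨φ, hφ⟩ := exists_clm_of_mem_TR₀ hτ hx
      exact ⟨φ, fun y _ hyx => Subtype.ext hyx ▸ hφ⟩
    · exact ⟨0, fun x hx hxa => absurd ⟨x, hx, hxa⟩ h⟩
  choose φ hφ using h1
  have hφ' : ∀ x ∈ X, ∀ b : A₀, φ x (corner x b) = τ (corner x b) := fun x hx => hφ x x hx rfl
  refine ⟨φ, ⟨?_, ?_⟩, hφ'⟩
  · rintro _ ⟨x, hx, rfl⟩ z hz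
    rw [← hdense x hx x hx] at hz
    have hcl : IsClosed {z : A | φ x (star z) = star (φ x z)} :=
      isClosed_eq ((φ x).continuous.comp continuous_star) (φ x).continuous.star
    refine closure_minimal ?_ hcl hz
    rintro _ ⟨b, rfl⟩
    have h2 := hφ' x hx (star b)
    rw [← star_corner, hτ.1, ← hφ' x hx b] at h2
    exact h2
  · rintro _ ⟨x, hx, rfl⟩ _ ⟨y, hy, rfl⟩ z hz
    rw [← hdense x hx y hy] at hz
    have hcl : IsClosed {z : A | φ x (z * star z) = φ y (star z * z)} :=
      isClosed_eq ((φ x).continuous.comp (by fun_prop)) ((φ y).continuous.comp (by fun_prop))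
    refine closure_minimal ?_ hcl hz
    rintro _ ⟨b, rfl⟩
    -- `w w*` lies in the corner of `x` and `w* w` in that of `y`, so traciality of `τ` on `A₀`
    -- links `φ x` and `φ y`.
    let w : A₀ := x * b * star y
    have h2 : w * star w = corner x (b * star y * (y * star b)) := by
      simp [w, corner, mul_assoc]
    have h3 : star w * w = corner y (star b * star x * (x * b)) := by
      simp [w, corner, mul_assoc]
    have h4 := hφ' x hx (b * star y * (y * star b))
    have h5 := hφ' y hy (star b * star x * (x * b))
    rw [← h2] at h4
    rw [← h3] at h5
    exact h4.trans ((hτ.2.1 _ _).trans h5.symm)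

variable [PartialOrder A] [StarOrderedRing A]

lemma cornerAlgebra_le_Ped {x : A} (hx : x ∈ Ped A) : cornerAlgebra x ≤ Ped A := fun _ ha =>
  mem_pedSpan_of_mem_rightIdeal hx (mem_rightIdeal_of_mem_closure ha)

/-- A trace on the Pedersen ideal agrees on `closure (x A x*)` with a bounded functional on `A`. -/
lemma exists_clm_of_mem_TR {τ : Ped A →ₗ[ℂ] ℂ} (hτ : τ ∈ TR A) {x : A} (hx : x ∈ Ped A) :
    ∃ φ : A →L[ℂ] ℂ, ∀ z : Ped A, (z : A) ∈ cornerAlgebra x → τ z = φ z := by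
  have hD := cornerAlgebra_le_Ped hx
  have hc := continuous_inclusion_of_mem_TR hτ hD
    (NonUnitalStarSubalgebra.isClosed_topologicalClosure _)
  let f : (cornerAlgebra x).toSubmodule →L[ℂ] ℂ :=
    { toFun := fun d => τ ⟨d, hD d.2⟩
      map_add' := fun a b => map_add τ (⟨a, hD a.2⟩ : Ped A) ⟨b, hD b.2⟩
      map_smul' := fun r a => map_smul τ r (⟨a, hD a.2⟩ : Ped A)
      cont := hc }
  obtain ⟨φ, hφ, -⟩ := exists_extension_norm_eq (cornerAlgebra x).toSubmodule f
  exact ⟨φ, fun z hz => (hφ ⟨z, hz⟩).symm⟩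

/-- Positivity is known only on squares from `A₀`, while `c` need not be a limit of elements of
`A₀`. Replacing `c` by `s = |c*|` keeps `c c*` and lands in `closure (x A₀ x*)`, where `φ` passes to
the limit. -/
lemma nonneg_map_mul_star {τ : Ped A →ₗ[ℂ] ℂ} (hτ : τ ∈ TR A)
    {A₀ : NonUnitalStarSubalgebra ℂ A} (hA₀ : A₀ ≤ Ped A) {x : A₀}
    (hdense : closure (Set.range fun a : A₀ => (x : A) * (a : A) * star (x : A)) =
      closure (Set.range fun a : A => (x : A) * a * star (x : A)))
    (hpos : ∀ a : A₀, 0 ≤ τ (NonUnitalStarSubalgebra.inclusion hA₀ (star a * a)))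
    {c : Ped A} (hc : (c : A) ∈ rightIdeal (x : A)) : 0 ≤ τ (c * star c) := by
  obtain ⟨φ, hφ⟩ := exists_clm_of_mem_TR hτ (hA₀ x.2)
  set s := CFC.sqrt ((c : A) * star (c : A)) with hs
  have hs0 : 0 ≤ s := CFC.sqrt_nonneg _
  have hss : s * s = (c : A) * star (c : A) :=
    CFC.sqrt_mul_sqrt_self _ (mul_star_self_nonneg (c : A))
  have hst : star s = s := (IsSelfAdjoint.of_nonneg hs0).star_eq
  have hrr := CFC.sqrt_mul_sqrt_self s hs0
  have hrst : star (CFC.sqrt s) = CFC.sqrt s :=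
    (IsSelfAdjoint.of_nonneg (CFC.sqrt_nonneg s)).star_eq
  have hsx : s ∈ rightIdeal (x : A) := by
    have h1 : s ∈ rightIdeal ((c : A) * star (c : A)) := hss ▸ self_mem_rightIdeal_mul_self hs0
    exact rightIdeal_le hc (rightIdeal_le (mul_mem_rightIdeal _ _) h1)
  have hrx : CFC.sqrt s ∈ rightIdeal (x : A) := by
    have h1 : CFC.sqrt s ∈ rightIdeal (CFC.sqrt s * CFC.sqrt s) :=
      self_mem_rightIdeal_mul_self (CFC.sqrt_nonneg s)
    rw [hrr] at h1
    exact rightIdeal_le hsx h1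
  have hmem : s ∈ closure (Set.range fun a : A₀ => (x : A) * (a : A) * star (x : A)) := by
    rw [hdense]
    have := mul_star_mem_closure hrx hrx
    rwa [hrst, hrr] at this
  have hcl : IsClosed {z : A | 0 ≤ φ (z * star z)} :=
    isClosed_le continuous_const (φ.continuous.comp (by fun_prop))
  have h1 : s ∈ {z : A | 0 ≤ φ (z * star z)} := by
    refine closure_minimal ?_ hcl hmem
    rintro _ ⟨a, rfl⟩
    have h2 := hpos (star (corner x a))
    rw [star_star] at h2
    rwa [hφ] at h2
    exact mul_mem (corner_mem_cornerAlgebra x a) (star_mem (corner_mem_cornerAlgebra x a))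
  have h2 : τ (c * star c) = φ ((c : A) * star (c : A)) :=
    hφ (c * star c) (mul_star_mem_closure hc hc)
  rw [h2, ← hss]
  nth_rewrite 2 [← hst]
  exact h1

end Corner

/-! ### The restriction map -/

section Restriction

variable {A : Type*} [NonUnitalCStarAlgebra A] [PartialOrder A] [StarOrderedRing A]
  {A₀ : NonUnitalStarSubalgebra ℂ A}

/-- The restriction map from `T_ℝ(A)` to `T_ℝ(A₀, X)`. -/
noncomputable def restrictTR (hA₀ : A₀ ≤ Ped A) (X : Set A₀) : TR A →ₗ[ℝ] TR₀ A₀ X where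
  toFun τ := ⟨(τ : Ped A →ₗ[ℂ] ℂ) ∘ₗ (NonUnitalStarSubalgebra.inclusion hA₀ : A₀ →ₗ[ℂ] Ped A), by
    refine ⟨fun a => τ.2.2.1 (NonUnitalStarSubalgebra.inclusion hA₀ a),
      fun a b => τ.2.2.2 (NonUnitalStarSubalgebra.inclusion hA₀ a)
        (NonUnitalStarSubalgebra.inclusion hA₀ b), fun x hx => ?_⟩
    obtain ⟨φ, hφ⟩ := exists_clm_of_mem_TR τ.2 (hA₀ x.2)
    refine ⟨‖φ‖, fun a => ?_⟩
    have h1 := hφ (NonUnitalStarSubalgebra.inclusion hA₀ (corner x a))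
      (corner_mem_cornerAlgebra x a)
    exact (congrArg norm h1).trans_le (φ.le_opNorm _)⟩
  map_add' _ _ := rfl
  map_smul' _ _ := rfl

lemma extEval_restrictTR (hA₀ : A₀ ≤ Ped A) {X : Set A₀} {x : A₀} (hx : x ∈ X)
    (hdense : closure (Set.range fun a : A₀ => (x : A) * (a : A) * star (x : A)) =
      closure (Set.range fun a : A => (x : A) * a * star (x : A)))
    (τ : TR A) {z : Ped A} (hz : (z : A) ∈ cornerAlgebra (x : A)) :
    extEval x (z : A) (restrictTR hA₀ X τ) = (τ : Ped A →ₗ[ℂ] ℂ) z := by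
  obtain ⟨φ, hφ⟩ := exists_clm_of_mem_TR τ.2 (hA₀ x.2)
  have hz' : (z : A) ∈ closure (Set.range fun b : A₀ => (corner x b : A)) := by
    rw [mem_cornerAlgebra_iff, ← hdense] at hz
    exact hz
  have : (comap (fun b : A₀ => (corner x b : A)) (𝓝 (z : A))).NeBot := by
    rw [comap_neBot_iff]
    intro t ht
    obtain ⟨_, h1, b, rfl⟩ := mem_closure_iff_nhds.mp hz' t ht
    exact ⟨b, h1⟩
  refine tendsto_nhds_unique (tendsto_extEval (restrictTR hA₀ X τ).2 hx hz') ?_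
  rw [hφ z hz]
  refine ((φ.continuous.tendsto _).comp tendsto_comap).congr fun b => ?_
  exact (hφ (NonUnitalStarSubalgebra.inclusion hA₀ (corner x b))
    (corner_mem_cornerAlgebra x b)).symm

lemma map_eq_sum_of_isDecomp {τ : Ped A →ₗ[ℂ] ℂ} (hτ : τ ∈ TR A) {p : Ped A} {X : Set A} {n : ℕ}
    {x : Fin n → A} {c : Fin n → Ped A} (h : IsDecomp X (p : A) x fun i => (c i : A)) :
    τ p = ∑ i, τ (c i * star (c i)) := by
  have h1 : p = ∑ i, star (c i) * c i := Subtype.ext (by rw [← h.sum_eq]; simp)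
  rw [h1, map_sum]
  exact Finset.sum_congr rfl fun i _ => hτ.2.2 _ _

lemma exists_mem_span_evalFunctionals (hA₀ : A₀ ≤ Ped A) {X : Set A₀}
    (hX : pedPos A ⊆ sumCone ((↑) '' X : Set A))
    (hdense : ∀ x ∈ X, closure (Set.range fun a : A₀ => (x : A) * (a : A) * star (x : A)) =
      closure (Set.range fun a : A => (x : A) * a * star (x : A))) (a : Ped A) :
    ∃ F ∈ Submodule.span ℂ (evalFunctionals X), ∀ τ : TR A,
      (τ : Ped A →ₗ[ℂ] ℂ) a = F (restrictTR hA₀ X τ) := by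
  obtain ⟨a, ha⟩ := a
  have ha' : a ∈ pedSpan A := ha
  induction ha' using Submodule.span_induction with
  | mem p hp =>
    obtain ⟨n, x, c, h⟩ := hX hp
    choose y hy hyx using h.mem
    have hc : ∀ i, c i ∈ Ped A := fun i =>
      mem_pedSpan_of_mem_rightIdeal (hyx i ▸ hA₀ (y i).2) (h.mem_rightIdeal i)
    have hcc : ∀ i, c i * star (c i) ∈ cornerAlgebra (y i : A) := fun i =>
      mul_star_mem_closure (hyx i ▸ h.mem_rightIdeal i) (hyx i ▸ h.mem_rightIdeal i)
    refine ⟨∑ i, fun τ : TR₀ A₀ X => extEval (y i) (c i * star (c i)) τ,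
      Submodule.sum_mem _ fun i _ =>
      Submodule.subset_span ⟨y i, hy i, _, hcc i, rfl⟩, fun τ => ?_⟩
    rw [map_eq_sum_of_isDecomp τ.2 (p := ⟨p, ha⟩) (c := fun i => ⟨c i, hc i⟩) h, Finset.sum_apply]
    exact Finset.sum_congr rfl fun i _ =>
      (extEval_restrictTR hA₀ (hy i) (hdense _ (hy i)) τ (z := ⟨c i, hc i⟩ * star ⟨c i, hc i⟩)
        (hcc i)).symm
  | zero => exact ⟨0, Submodule.zero_mem _, fun τ => map_zero (τ : Ped A →ₗ[ℂ] ℂ)⟩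
  | add a b ha1 hb1 iha ihb =>
    obtain ⟨F, hF, hF'⟩ := iha ha1
    obtain ⟨G, hG, hG'⟩ := ihb hb1
    refine ⟨F + G, Submodule.add_mem _ hF hG, fun τ => ?_⟩
    rw [Pi.add_apply, ← hF', ← hG', ← map_add]
    rfl
  | smul r a ha1 iha =>
    obtain ⟨F, hF, hF'⟩ := iha ha1
    refine ⟨r • F, Submodule.smul_mem _ _ hF, fun τ => ?_⟩
    rw [Pi.smul_apply, ← hF', ← map_smul]
    rfl

lemma restrictTR_surjective (hA₀ : A₀ ≤ Ped A) {X : Set A₀}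
    (hXA₀ : X * (Set.univ : Set A₀) = Set.univ) (hX : pedPos A ⊆ sumCone ((↑) '' X : Set A))
    (hdense : ∀ x ∈ X, ∀ y ∈ X,
      closure (Set.range fun a : A₀ => (x : A) * (a : A) * star (y : A)) =
        closure (Set.range fun a : A => (x : A) * a * star (y : A))) :
    Function.Surjective (restrictTR hA₀ X) := by
  intro τ₀
  obtain ⟨φ, hφ, hφτ⟩ := exists_isTraceFamily τ₀.2 hdense
  obtain ⟨τ, hτ, hτφ⟩ := hφ.exists_mem_TR hX
  have hfac : ∀ a : A₀, ∃ x ∈ X, ∃ b, x * b = a := fun a => by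
    have : a ∈ X * (Set.univ : Set A₀) := by rw [hXA₀]; exact Set.mem_univ a
    obtain ⟨x, hx, b, -, h⟩ := Set.mem_mul.mp this
    exact ⟨x, hx, b, h⟩
  refine ⟨⟨τ, hτ⟩, Subtype.ext (LinearMap.ext fun a => ?_)⟩
  obtain ⟨x, -, b, rfl⟩ := hfac a
  -- As `A₀ = X A₀`, every element is a product, so polarization reduces to elements `z z*`;
  -- factoring `z = x b` once more puts `z z*` in the corner of `x`.
  refine linearMap_eq_of_mul_star_self (fun z => ?_) x b
  obtain ⟨x, hx, b, rfl⟩ := hfac z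
  set c := NonUnitalStarSubalgebra.inclusion hA₀ (x * b) with hc
  have h1 : τ (c * star c) = τ (star c * c) := hτ.2.2 _ _
  have h2 := hτφ (star c * c) 1 (fun _ => x) (fun _ => c)
    (IsDecomp.single ⟨x, hx, rfl⟩ (mul_mem_rightIdeal (x : A) (b : A)))
  rw [← h1, Fin.sum_univ_one] at h2
  refine (show τ (c * star c) = _ from h2).trans ?_
  have h3 := hφτ x hx (b * star b)
  rw [← mul_mul_star_mul] at h3
  exact h3

end Restriction

end PedTrace
theorem proposition5p3 {A : Type*} [NonUnitalCStarAlgebra A] [PartialOrder A] [StarOrderedRing A]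
    (A₀ : NonUnitalStarSubalgebra ℂ A) (hA₀ : A₀ ≤ PedTrace.Ped A) (X : Set A₀)
    (hXA₀ : X * (Set.univ : Set A₀) = Set.univ)
    (hX : ∀ I : Submodule ℂ A, IsClosed (I : Set A) →
      (∀ a b : A, b ∈ I → a * b ∈ I ∧ b * a ∈ I) → (∀ x ∈ X, (x : A) ∈ I) → I = ⊤)
    (hdense : ∀ x ∈ X, ∀ y ∈ X,
      closure (Set.range fun a : A₀ => (x : A) * (a : A) * star (y : A)) =
        closure (Set.range fun a : A => (x : A) * a * star (y : A))) :
    ∃ Φ : PedTrace.TR A ≃L[ℝ] PedTrace.TR₀ A₀ X,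
      (∀ (τ : PedTrace.TR A) (a : A₀),
        (Φ τ : A₀ →ₗ[ℂ] ℂ) a =
          (τ : PedTrace.Ped A →ₗ[ℂ] ℂ) (NonUnitalStarSubalgebra.inclusion hA₀ a)) ∧
      ∀ τ : PedTrace.TR A, Φ τ ∈ PedTrace.TPos₀ A₀ X ↔ τ ∈ PedTrace.TPos A := by
  have hcone : PedTrace.pedPos A ⊆ PedTrace.sumCone ((↑) '' X : Set A) :=
    PedTrace.pedPos_subset_sumCone fun I hI hI' hXI =>
      hX I hI hI' fun x hx => hXI ⟨x, hx, rfl⟩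
  have heval := PedTrace.exists_mem_span_evalFunctionals hA₀ hcone fun x hx => hdense x hx x hx
  have hinj : Function.Injective (PedTrace.restrictTR hA₀ X) := fun τ σ h => by
    refine Subtype.ext (LinearMap.ext fun a => ?_)
    obtain ⟨F, -, hF⟩ := heval a
    rw [hF, hF, h]
  let Ψ := LinearEquiv.ofBijective (PedTrace.restrictTR hA₀ X)
    ⟨hinj, PedTrace.restrictTR_surjective hA₀ hXA₀ hcone hdense⟩
  have hΨ : Continuous Ψ := by
    refine continuous_iInf_rng.mpr fun x => continuous_iInf_rng.mpr fun hx =>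
      continuous_iInf_rng.mpr fun a => continuous_iInf_rng.mpr fun ha =>
        continuous_induced_rng.mpr ?_
    have ha' : a ∈ PedTrace.Ped A := PedTrace.cornerAlgebra_le_Ped (hA₀ x.2) ha
    have h1 : Continuous fun τ : PedTrace.TR A => (τ : PedTrace.Ped A →ₗ[ℂ] ℂ) ⟨a, ha'⟩ :=
      (continuous_apply (⟨a, ha'⟩ : PedTrace.Ped A)).comp continuous_induced_dom
    refine h1.congr fun τ => ?_
    exact (PedTrace.extEval_restrictTR hA₀ hx (hdense x hx x hx) τ (z := ⟨a, ha'⟩) ha).symm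
  have hΨs : Continuous Ψ.symm := by
    refine continuous_induced_rng.mpr (continuous_pi fun a => ?_)
    obtain ⟨F, hF, hFτ⟩ := heval a
    refine (PedTrace.continuous_of_mem_span_evalFunctionals hF).congr fun τ₀ => ?_
    have h1 := hFτ (Ψ.symm τ₀)
    have h2 : PedTrace.restrictTR hA₀ X (Ψ.symm τ₀) = τ₀ := Ψ.apply_symm_apply τ₀
    rw [h2] at h1
    exact h1.symm
  refine ⟨{ Ψ with continuous_toFun := hΨ, continuous_invFun := hΨs }, fun τ a => rfl,
    fun τ => ⟨fun h a ha => ?_, fun h a => ?_⟩⟩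
  -- Positivity of the restriction gives `τ a = ∑ τ (cᵢ cᵢ*) ≥ 0`, corner by corner.
  · obtain ⟨n, x, c, hd⟩ := hcone (PedTrace.mem_pedPos_of_nonneg a.2 ha)
    choose y hy hyx using hd.mem
    have hcy : ∀ i, c i ∈ PedTrace.rightIdeal (y i : A) := fun i => hyx i ▸ hd.mem_rightIdeal i
    have hc : ∀ i, c i ∈ PedTrace.Ped A := fun i =>
      PedTrace.mem_pedSpan_of_mem_rightIdeal (hA₀ (y i).2) (hcy i)
    rw [PedTrace.map_eq_sum_of_isDecomp τ.2 (c := fun i => ⟨c i, hc i⟩) hd]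
    exact Finset.sum_nonneg fun i _ => PedTrace.nonneg_map_mul_star τ.2 hA₀
      (hdense _ (hy i) _ (hy i)) h (hcy i)
  · exact h (NonUnitalStarSubalgebra.inclusion hA₀ (star a * a)) (star_mul_self_nonneg (a : A))
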